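/- Let $T>0$, let $U\subset\mathbb R^m$ be compact, and let $f:[0,T]\times\mathbb R^n\times\mathbb R^m\to\mathbb R^n$ be continuous, with $x\mapsto f(t,x,u)$ continuously differentiable for all $(t,u)$, with $|f|\le M$ and $|\nabla_xf|\le M$ on $[0,T]\times\mathbb R^n\times U$ for some $M>0$, and with $f(t,x,U)$ convex for every $(t,x)$. Let $\psi:[0,T]\times\mathbb R^n\to\mathbb R$ be $C^2$, with $\lim_{|x|\to\infty}\psi(t,x)=+\infty$ for every $t\in[0,T]$, and suppose that there are $\beta,\eta>0$ such that $\psi(t,x)\ge-\beta$ implies $|\nabla_x\psi(t,x)|>\eta$. Put $C(t)=\{x:\psi(t,x)\le0\}$ and let $N_{C(t)}$ be its (Mordukhovich) normal cone, which is empty outside $C(t)$. Let $\mu$ be such that $$|\nabla_x\psi(t,x)||f(t,x,u)|+|\partial_t\psi(t,x)|+1\le\mu\quad\text{for all }t\in[0,T],\ u\in U,\ x\in C(t)+B_n,$$ where $B_n$ is the closed unit ball. Let $\sigma_k\downarrow0$, let $\gamma_k>0$ with $\gamma_k\to\infty$, put $\mu_k=\frac1{\gamma_k}\log\frac{\mu}{\eta^2\gamma_k}$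 and $C^k(t)=\{x:\psi(t,x)-\sigma_k\le\mu_k\}$, and assume that $C(t)\subset\operatorname{int}C^k(t)$ for all $k$ and all $t\in[0,T]$. A control is a measurable function $u$ on $[0,T]$ with $u(t)\in U$ for a.e. $t$; solutions are absolutely continuous functions on $[0,T]$ satisfying the equation or inclusion for a.e. $t\in[0,T]$. Consider, for controls $u_k$ and $u$, $$(1)\quad \dot x_k=f(t,x_k,u_k)-\gamma_ke^{\gamma_k(\psi(t,x_k)-\sigma_k)}\nabla_x\psi(t,x_k),\qquad x_k(0)=b_k\in C^k(0),$$ $$(2)\quad \dot x\in f(t,x,u)-N_{C(t)}(x),\qquad x(0)=x_0,$$ $$(3)\quad \dot x\in f(t,x,U)-N_{C(t)}(x),\qquad x(0)=x_0\in C(0).$$ Then: (i) For every control $u$ and every $x_0$, problem (2) has at most one solution. (ii) If $u_k$ are controls, $x_k$ are solutions of (1) and $b_k\to x_0$, then a subsequence of $\{x_k\}$ converges uniformly on $[0,T]$ to a function $x$ that is, for some control $u$, the solution of (2). (iii) If, moreover, $u_k=u$ for all $k$, then $\{x_k\}$ converges uniformly on $[0,T]$ to the solution of (2) with this same control $u$.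 (iv) For every solution $x$ of (3) there is a control $u$ such that $x$ is the solution of (2) with $u$, and for every sequence $b_k\in C^k(0)$ with $b_k\to x_0$ the problems (1) with $u_k=u$ have, for all sufficiently large $k$, solutions $x_k$ on $[0,T]$, and these converge uniformly to $x$. -/

import Mathlib

open Set Filter Topology MeasureTheory
open scoped Pointwise

noncomputable section

namespace Sweeping

/-- `v` is a proximal normal to the set `S` at the point `s ∈ S`. -/
def IsProximalNormal {E : Type*} [NormedAddCommGroup E] [InnerProductSpace ℝ E]
    (S : Set E) (s v : E) : Prop :=
  s ∈ S ∧ ∃ c : ℝ, 0 ≤ c ∧ ∀ y ∈ S, inner ℝ v (y - s) ≤ c * ‖y - s‖ ^ 2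

/-- The Mordukhovich (limiting) normal cone to `S` at `s`: the limits of proximal normals at points
of `S` converging to `s`. It is empty for `s ∉ S`. -/
def normalCone {E : Type*} [NormedAddCommGroup E] [InnerProductSpace ℝ E]
    (S : Set E) (s : E) : Set E :=
  {v | s ∈ S ∧ ∃ (p w : ℕ → E), (∀ i, IsProximalNormal S (p i) (w i)) ∧
    Tendsto p atTop (𝓝 s) ∧ Tendsto w atTop (𝓝 v)}

/-- The moving set `C(t) = {x | ψ(t,x) ≤ 0}`. -/
def movingSet {E : Type*} (ψ : ℝ → E → ℝ) (t : ℝ) : Set E :=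
  {x | ψ t x ≤ 0}

/-- The number `μ(γ) = (1/γ) log (μ / (η² γ))`. -/
def penaltyLevel (μ η γ : ℝ) : ℝ :=
  1 / γ * Real.log (μ / (η ^ 2 * γ))

/-- The enlarged set `{x | ψ(t,x) - σ ≤ μ(γ)}`; it is `C^k(t)` for `σ = σ_k` and `γ = γ_k`. -/
def enlargedSet {E : Type*} (ψ : ℝ → E → ℝ) (μ η σ γ : ℝ) (t : ℝ) : Set E :=
  {x | ψ t x - σ ≤ penaltyLevel μ η γ}

/-- `u` is a (Lebesgue) measurable control on `[0,T]` with `u(t) ∈ U` for a.e. `t`. -/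
def IsControl {F : Type*} [MeasurableSpace F] (T : ℝ) (U : Set F) (u : ℝ → F) : Prop :=
  AEMeasurable u (volume.restrict (Icc 0 T)) ∧ ∀ᵐ t ∂(volume.restrict (Icc (0 : ℝ) T)), u t ∈ U

/-- `x` is an absolutely continuous solution on `[0,T]` of the penalized differential equation
`ẋ = f(t,x,u) - γ exp(γ(ψ(t,x) - σ)) ∇ₓψ(t,x)`. -/
def IsPenalizedSolution {E F : Type*} [NormedAddCommGroup E] [InnerProductSpace ℝ E]
    [CompleteSpace E] (T : ℝ) (f : ℝ → E → F → E) (ψ : ℝ → E → ℝ) (σ γ : ℝ)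
    (u : ℝ → F) (x : ℝ → E) : Prop :=
  AbsolutelyContinuousOnInterval x 0 T ∧
  ∀ᵐ t ∂(volume.restrict (Icc (0 : ℝ) T)),
    HasDerivAt x
      (f t (x t) (u t) - (γ * Real.exp (γ * (ψ t (x t) - σ))) • gradient (ψ t) (x t)) t

/-- `x` is an absolutely continuous solution on `[0,T]` of the controlled sweeping process
`ẋ ∈ f(t,x,u) - N_{C(t)}(x)`, `x(0) = x₀`, for the given control `u`. -/
def IsSweepingSolution {E F : Type*} [NormedAddCommGroup E] [InnerProductSpace ℝ E]
    (T : ℝ) (f : ℝ → E → F → E) (ψ : ℝ → E → ℝ)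
    (u : ℝ → F) (x₀ : E) (x : ℝ → E) : Prop :=
  AbsolutelyContinuousOnInterval x 0 T ∧ x 0 = x₀ ∧
  ∀ᵐ t ∂(volume.restrict (Icc (0 : ℝ) T)),
    ∃ v ∈ ({f t (x t) (u t)} : Set E) - normalCone (movingSet ψ t) (x t), HasDerivAt x v t

/-- `x` is an absolutely continuous solution on `[0,T]` of the sweeping inclusion
`ẋ ∈ f(t,x,U) - N_{C(t)}(x)`, `x(0) = x₀`. -/
def IsInclusionSolution {E F : Type*} [NormedAddCommGroup E] [InnerProductSpace ℝ E]
    (T : ℝ) (f : ℝ → E → F → E) (ψ : ℝ → E → ℝ)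
    (U : Set F) (x₀ : E) (x : ℝ → E) : Prop :=
  AbsolutelyContinuousOnInterval x 0 T ∧ x 0 = x₀ ∧
  ∀ᵐ t ∂(volume.restrict (Icc (0 : ℝ) T)),
    ∃ v ∈ (fun w => f t (x t) w) '' U - normalCone (movingSet ψ t) (x t), HasDerivAt x v t

end Sweeping

end

/-! Since `∇ψ` does not vanish near the boundary, the normal cone to `C(t)` at a boundary point is
the ray spanned by `∇ψ`, and it is `{0}` at points with `ψ < 0` (`exists_smul_of_mem_normalCone`,
`smul_gradient_mem_normalCone`). So the sweeping process reads `ẋ = f - l ∇ψ` with `l ≥ 0` and `l ψ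
= 0`, and the penalized equation has the same shape with `l` replaced by `γ exp(γ(ψ - σ))`.

Both multipliers are at most `μ/η²`. For the exact one, `ψ(t,x(t))` is maximal at active times, so
its derivative vanishes there (`multiplier_le`). For the penalized one, the level defining `C^k` is
where the multiplier equals `μ/η²`; above it the penalty beats the drift of `ψ`, so for large `k`
the sets `C^k` are invariant (`mem_enlargedSet_of_penalized`).

Uniqueness is Gronwall for `‖y - z‖²`: as `ψ` is `C²`, bounded multiples of `∇ψ` are monotone up to
a quadratic error (`smul_gradient_inner_le`).

For the limit, the bounds make the `x_k`, the integrals of the multipliers and the integrals of the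
penalty vectors equi-Lipschitz, and Arzelà–Ascoli applies. Derivatives of the limits are located by
a mean value theorem for closed convex sets (`hasDerivAt_mem_of_tendsto`), which plays the role of
weak convergence of derivatives. Convexity of `f(t,x,U)` keeps the limit velocity in that set, and a
measurable selection yields a control (`exists_control`). For a common control the velocity is
identified by comparison with one fixed curve of the sequence, and uniqueness then gives convergence
of the whole sequence. Part (iv) combines the selection, solvability of the penalized equation
(`exists_penalizedSolution`) and this convergence. -/

namespace Sweeping

/-! ### Absolutely continuous and Lipschitz curves, and limits of their derivatives -/

section Calculus

variable {W : Type*} [NormedAddCommGroup W] [NormedSpace ℝ W]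

lemma lipschitzWith_comp_absolutelyContinuous {X Y : Type*} [PseudoMetricSpace X]
    [PseudoMetricSpace Y] {K : NNReal} {Φ : X → Y} (hΦ : LipschitzWith K Φ) {w : ℝ → X} {a b : ℝ}
    (hw : AbsolutelyContinuousOnInterval w a b) :
    AbsolutelyContinuousOnInterval (fun t => Φ (w t)) a b := by
  rw [absolutelyContinuousOnInterval_iff] at hw ⊢
  intro ε hε
  obtain ⟨δ, hδ, h⟩ := hw (ε / (K + 1)) (by positivity)
  refine ⟨δ, hδ, fun I hI hlt => ?_⟩
  have h1 := h I hI hlt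
  calc _ ≤ ∑ i ∈ Finset.range I.1, (K : ℝ) * dist (w (I.2 i).1) (w (I.2 i).2) :=
        Finset.sum_le_sum fun i _ => hΦ.dist_le_mul _ _
    _ = K * ∑ i ∈ Finset.range I.1, dist (w (I.2 i).1) (w (I.2 i).2) := by rw [Finset.mul_sum]
    _ ≤ (K + 1) * ∑ i ∈ Finset.range I.1, dist (w (I.2 i).1) (w (I.2 i).2) := by
        gcongr; linarith
    _ < (K + 1) * (ε / (K + 1)) := by gcongr
    _ = ε := by field_simp

/-- The fundamental theorem of calculus for absolutely continuous functions. The bound is asked of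
any derivative that exists, since almost everywhere differentiability is automatic for a real
function. -/
lemma sub_le_of_ae_hasDerivAt_le {q : ℝ → ℝ} {a b c : ℝ} (hab : a ≤ b)
    (hq : AbsolutelyContinuousOnInterval q a b)
    (h : ∀ᵐ t ∂(volume.restrict (Icc a b)), ∀ d, HasDerivAt q d t → d ≤ c) :
    q b - q a ≤ c * (b - a) := by
  rw [← hq.integral_deriv_eq_sub]
  have h2 : ∀ᵐ t ∂(volume.restrict (Icc a b)), deriv q t ≤ c := by
    have hd : ∀ᵐ t ∂(volume.restrict (Icc a b)), DifferentiableAt ℝ q t := by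
      rw [ae_restrict_iff' measurableSet_Icc]
      simpa [uIcc_of_le hab] using hq.ae_differentiableAt
    filter_upwards [h, hd] with t ht hdt using ht _ hdt.hasDerivAt
  calc ∫ t in a..b, deriv q t ≤ ∫ t in a..b, c :=
        intervalIntegral.integral_mono_ae_restrict hab hq.intervalIntegrable_deriv (by simp) h2
    _ = c * (b - a) := by simp [mul_comm]

/-- Mean value theorem for absolutely continuous curves and closed convex sets. -/
lemma slope_mem_of_ae_hasDerivAt_mem {B : ℝ → W} {a b : ℝ} (hab : a < b) {Q : Set W}
    (hQc : Convex ℝ Q) (hQ : IsClosed Q) (hB : AbsolutelyContinuousOnInterval B a b)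
    (h : ∀ᵐ t ∂(volume.restrict (Icc a b)), ∃ d ∈ Q, HasDerivAt B d t) :
    (b - a)⁻¹ • (B b - B a) ∈ Q := by
  by_contra hne
  -- A functional separating the slope from `Q` reduces the claim to the scalar estimate: `l ∘ B`
  -- has derivative at most `u`, hence so is its slope.
  obtain ⟨l, u, hlu, hu⟩ := geometric_hahn_banach_closed_point hQc hQ hne
  have hl : AbsolutelyContinuousOnInterval (fun t => l (B t)) a b :=
    lipschitzWith_comp_absolutelyContinuous l.lipschitz hB
  have := sub_le_of_ae_hasDerivAt_le (c := u) hab.le hl (by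
    filter_upwards [h] with t ht d hd
    obtain ⟨e, heQ, he⟩ := ht
    have h1 : HasDerivAt (fun t => l (B t)) (l e) t := l.hasFDerivAt.comp_hasDerivAt t he
    rw [hd.unique h1]
    exact (hlu e heQ).le)
  rw [map_smul, map_sub, smul_eq_mul] at hu
  have hpos : 0 < b - a := sub_pos.2 hab
  rw [inv_mul_eq_div, lt_div_iff₀ hpos] at hu
  linarith

lemma lipschitzOnWith_of_ae_hasDerivAt_norm_le {B : ℝ → W} {a b : ℝ} {L : NNReal}
    (hB : AbsolutelyContinuousOnInterval B a b) (hab : a ≤ b)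
    (h : ∀ᵐ t ∂(volume.restrict (Icc a b)), ∃ d, ‖d‖ ≤ L ∧ HasDerivAt B d t) :
    LipschitzOnWith L B (Icc a b) := by
  have key : ∀ s ∈ Icc a b, ∀ t ∈ Icc a b, s < t → ‖B t - B s‖ ≤ L * (t - s) := by
    intro s hs t ht hst
    have := slope_mem_of_ae_hasDerivAt_mem hst (convex_closedBall (0 : W) L)
      Metric.isClosed_closedBall (hB.mono (by
        rw [uIcc_of_le hst.le, uIcc_of_le hab]; exact Icc_subset_Icc hs.1 ht.2)) (by
        filter_upwards [ae_restrict_of_ae_restrict_of_subset (Icc_subset_Icc hs.1 ht.2) h]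
          with r hr
        obtain ⟨d, hd, hd'⟩ := hr
        exact ⟨d, by simpa using hd, hd'⟩)
    rw [mem_closedBall_zero_iff, norm_smul, norm_inv, Real.norm_eq_abs,
      abs_of_pos (sub_pos.2 hst), inv_mul_le_iff₀ (sub_pos.2 hst)] at this
    linarith
  refine LipschitzOnWith.of_dist_le_mul fun s hs t ht => ?_
  rcases lt_trichotomy s t with hst | rfl | hst
  · have := key s hs t ht hst
    rw [dist_comm, dist_eq_norm, dist_comm, Real.dist_eq, abs_of_pos (sub_pos.2 hst)]
    exact this
  · simp
  · have := key t ht s hs hst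
    rw [dist_eq_norm, Real.dist_eq, abs_of_pos (sub_pos.2 hst)]
    exact this

lemma ae_restrict_Icc_mem_Ioo (a b : ℝ) :
    ∀ᵐ t ∂(volume.restrict (Icc a b)), t ∈ Ioo a b := by
  rw [← restrict_Ioo_eq_restrict_Icc]
  exact ae_restrict_mem measurableSet_Ioo

lemma ae_differentiableAt_of_lipschitzOnWith [FiniteDimensional ℝ W] {B : ℝ → W} {a b : ℝ}
    {L : NNReal} (hB : LipschitzOnWith L B (Icc a b)) :
    ∀ᵐ t ∂(volume.restrict (Icc a b)), DifferentiableAt ℝ B t := by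
  filter_upwards [ae_restrict_Icc_mem_Ioo a b,
    (ae_restrict_iff' measurableSet_Icc).2 hB.ae_differentiableWithinAt_of_mem_real] with t ht h
  exact h.differentiableAt (Icc_mem_nhds ht.1 ht.2)

lemma absolutelyContinuous_of_lipschitzOnWith {X : Type*} [PseudoMetricSpace X] {B : ℝ → X}
    {a b : ℝ} (hab : a ≤ b) {L : NNReal} (hB : LipschitzOnWith L B (Icc a b)) :
    AbsolutelyContinuousOnInterval B a b :=
  LipschitzOnWith.absolutelyContinuousOnInterval (K := L) (by rwa [uIcc_of_le hab])

/-- The derivative of a truncation `max a (min (h t) b)` vanishes outside `{a < h < b}`. -/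
lemma hasDerivAt_trunc {h : ℝ → ℝ} {a b d t : ℝ} (hab : a ≤ b) (hc : ContinuousAt h t)
    (hd : HasDerivAt (fun s => max a (min (h s) b)) d t) :
    d = 0 ∨ (a < h t ∧ h t < b ∧ HasDerivAt h d t) := by
  rcases le_or_gt (h t) a with h1 | h1
  · left
    refine IsLocalMin.hasDerivAt_eq_zero (Eventually.of_forall fun s => ?_) hd
    simp [min_eq_left (h1.trans hab), h1]
  rcases le_or_gt b (h t) with h2 | h2
  · left
    refine IsLocalMax.hasDerivAt_eq_zero (Eventually.of_forall fun s => ?_) hd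
    simp [min_eq_right h2, hab]
  · right
    refine ⟨h1, h2, hd.congr_of_eventuallyEq ?_⟩
    filter_upwards [hc.eventually (lt_mem_nhds h1), hc.eventually (gt_mem_nhds h2)] with s hs1 hs2
    rw [min_eq_left hs2.le, max_eq_right hs1.le]

lemma lipschitzOnWith_trunc {h : ℝ → ℝ} {s : Set ℝ} {L : NNReal} (hh : LipschitzOnWith L h s)
    (a b : ℝ) : LipschitzOnWith L (fun t => max a (min (h t) b)) s := by
  refine LipschitzOnWith.of_dist_le_mul fun x hx y hy => ?_
  refine le_trans ?_ (hh.dist_le_mul x hx y hy)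
  simp only [Real.dist_eq]
  have h1 : |max a (min (h x) b) - max a (min (h y) b)| ≤ |min (h x) b - min (h y) b| := by
    simpa [max_comm] using abs_max_sub_max_le_abs (min (h x) b) (min (h y) b) a
  have h2 := abs_min_sub_min_le_max (h x) b (h y) b
  simp at h2
  exact h1.trans h2

/-- A Lipschitz function starting in `(-∞, a]` stays there, if it decreases on `{a < h < b}`. -/
lemma le_of_ae_hasDerivAt_nonpos_of_mem {h : ℝ → ℝ} {T a b : ℝ} (hab : a < b) {L : NNReal}
    (hh : LipschitzOnWith L h (Icc 0 T)) (h0 : h 0 ≤ a)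
    (hd : ∀ᵐ t ∂(volume.restrict (Icc 0 T)), a < h t → h t < b → ∀ d, HasDerivAt h d t → d ≤ 0) :
    ∀ t ∈ Icc 0 T, h t ≤ a := by
  intro t ht
  have hsub : Icc 0 t ⊆ Icc 0 T := Icc_subset_Icc_right ht.2
  -- The truncation of `h` to `[a, b]` has nonpositive derivative everywhere it is differentiable,
  -- up to a null set, so nothing has to be known about `h` above `b`.
  have hq := lipschitzOnWith_trunc hh a b
  have := sub_le_of_ae_hasDerivAt_le (c := 0) ht.1
    (absolutelyContinuous_of_lipschitzOnWith ht.1 (hq.mono hsub)) (by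
      filter_upwards [ae_restrict_of_ae_restrict_of_subset hsub hd,
        ae_restrict_of_ae_restrict_of_subset hsub (ae_restrict_Icc_mem_Ioo 0 T)] with s hs hs' d hds
      rcases hasDerivAt_trunc hab.le
        (hh.continuousOn.continuousAt (Icc_mem_nhds hs'.1 hs'.2)) hds with h3 | ⟨h3, h4, h5⟩
      · exact h3.le
      · exact hs h3 h4 d h5)
  by_contra hlt
  push Not at hlt
  rw [min_eq_left (h0.trans hab.le), max_eq_left h0] at this
  have h6 : a < max a (min (h t) b) := lt_max_of_lt_right (lt_min hlt hab)
  linarith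

/-- Gronwall's inequality for Lipschitz functions, with zero initial value. -/
lemma nonpos_of_ae_hasDerivAt_le_mul {q : ℝ → ℝ} {T C : ℝ} {L : NNReal}
    (hq : LipschitzOnWith L q (Icc 0 T)) (h0 : q 0 ≤ 0)
    (hd : ∀ᵐ t ∂(volume.restrict (Icc 0 T)), ∃ d, HasDerivAt q d t ∧ d ≤ C * q t) :
    ∀ t ∈ Icc 0 T, q t ≤ 0 := by
  intro t ht
  have hsub : Icc 0 t ⊆ Icc 0 T := Icc_subset_Icc_right ht.2
  have hexp : AbsolutelyContinuousOnInterval (fun s => Real.exp (-C * s)) 0 t :=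
    ContDiffOn.absolutelyContinuousOnInterval (by fun_prop)
  have hac := hexp.mul (absolutelyContinuous_of_lipschitzOnWith ht.1 (hq.mono hsub))
  have := sub_le_of_ae_hasDerivAt_le (c := 0) ht.1 hac (by
      filter_upwards [ae_restrict_of_ae_restrict_of_subset hsub hd] with s hs d hds
      obtain ⟨e, he, hle⟩ := hs
      have h1 : HasDerivAt (fun s => Real.exp (-C * s)) (Real.exp (-C * s) * -C) s := by
        simpa using ((hasDerivAt_id s).const_mul (-C)).exp
      rw [hds.unique (h1.mul he)]
      have := mul_le_mul_of_nonneg_left hle (Real.exp_pos (-C * s)).le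
      linarith)
  simp only [Pi.mul_apply, mul_zero, Real.exp_zero, one_mul, zero_mul] at this
  have h3 : Real.exp (-C * t) * q t ≤ 0 := by linarith
  by_contra hlt
  push Not at hlt
  have := mul_pos (Real.exp_pos (-C * t)) hlt
  linarith

/-- If curves `B k` converge pointwise to `B`, and near `t` the derivatives of `B k` lie in a closed
convex set, then so does the derivative of `B` at `t`. -/
lemma hasDerivAt_mem_of_tendsto {B : ℕ → ℝ → W} {B₀ : ℝ → W} {T t δ : ℝ} (ht : t ∈ Ioo 0 T)
    (hδ : 0 < δ) {Q : Set W} (hQc : Convex ℝ Q) (hQ : IsClosed Q)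
    (hB : ∀ᶠ k in atTop, AbsolutelyContinuousOnInterval (B k) 0 T)
    (hd : ∀ᶠ k in atTop, ∀ᵐ s ∂(volume.restrict (Icc 0 T)), s ∈ Icc t (t + δ) →
      ∃ d ∈ Q, HasDerivAt (B k) d s)
    (hlim : ∀ s ∈ Icc 0 T, Tendsto (fun k => B k s) atTop (𝓝 (B₀ s)))
    {d : W} (hB₀ : HasDerivAt B₀ d t) : d ∈ Q := by
  -- Right difference quotients suffice: those of `B k` lie in `Q` by the mean value theorem, and
  -- closedness of `Q` passes this first to the limit in `k`, then to `s → t`.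
  have h1 : Tendsto (fun s => (s - t)⁻¹ • (B₀ s - B₀ t)) (𝓝[>] t) (𝓝 d) :=
    (hasDerivWithinAt_iff_tendsto_slope' (self_notMem_Ioi)).1 hB₀.hasDerivWithinAt
  refine hQ.mem_of_tendsto h1 ?_
  filter_upwards [Ioo_mem_nhdsGT (show t < min (t + δ) T from lt_min (by linarith) ht.2)] with s hs
  have hsT : s ∈ Icc 0 T := ⟨(ht.1.trans hs.1).le, (hs.2.trans_le (min_le_right _ _)).le⟩
  have hsub : Icc t s ⊆ Icc 0 T := Icc_subset_Icc ht.1.le hsT.2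
  refine hQ.mem_of_tendsto
    (((hlim s hsT).sub (hlim t (Ioo_subset_Icc_self ht))).const_smul ((s - t)⁻¹)) ?_
  filter_upwards [hB, hd] with k hk1 hk2
  refine slope_mem_of_ae_hasDerivAt_mem hs.1 hQc hQ (hk1.mono ?_) ?_
  · rwa [uIcc_of_le hs.1.le, uIcc_of_le (ht.1.trans ht.2).le]
  · filter_upwards [ae_restrict_of_ae_restrict_of_subset hsub hk2,
      ae_restrict_mem measurableSet_Icc] with r hr hr'
    exact hr ⟨hr'.1, hr'.2.trans (hs.2.le.trans (min_le_left _ _))⟩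

/-- Turns multipliers and penalty vectors into curves, so that their limits can be defined as
derivatives of limit curves. -/
lemma exists_lipschitz_primitive [CompleteSpace W] {w : ℝ → W} {T : ℝ} (hT : 0 ≤ T)
    (hw : ContinuousOn w (Icc 0 T)) {C : NNReal} (hC : ∀ t ∈ Icc 0 T, ‖w t‖ ≤ C) :
    ∃ I : ℝ → W, I 0 = 0 ∧ LipschitzOnWith C I (Icc 0 T) ∧
      ∀ t ∈ Ioo 0 T, HasDerivAt I (w t) t := by
  have hcont : Continuous (IccExtend hT ((Icc 0 T).domRestrict w)) := by
    exact (continuousOn_iff_continuous_domRestrict.1 hw).Icc_extend'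
  have hd : ∀ t, HasDerivAt (fun t => ∫ s in (0 : ℝ)..t, IccExtend hT ((Icc 0 T).domRestrict w) s)
      (IccExtend hT ((Icc 0 T).domRestrict w) t) t := fun t =>
    intervalIntegral.integral_hasDerivAt_right (hcont.intervalIntegrable _ _)
      hcont.aestronglyMeasurable.stronglyMeasurableAtFilter hcont.continuousAt
  refine ⟨fun t => ∫ s in (0 : ℝ)..t, IccExtend hT ((Icc 0 T).domRestrict w) s, by simp, ?_, ?_⟩
  · refine (convex_Icc 0 T).lipschitzOnWith_of_nnnorm_hasDerivWithin_le
      (fun t _ => (hd t).hasDerivWithinAt) fun t ht => ?_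
    rw [IccExtend_of_mem _ _ ht]
    exact hC t ht
  · intro t ht
    have := hd t
    rwa [IccExtend_of_mem _ _ (Ioo_subset_Icc_self ht)] at this

/-- Arzelà–Ascoli for equi-Lipschitz sequences of curves. -/
lemma exists_subseq_tendstoUniformlyOn [FiniteDimensional ℝ W] {X : ℕ → ℝ → W} {T R : ℝ}
    (hT : 0 ≤ T) {L : NNReal} (hX : ∀ k, LipschitzOnWith L (X k) (Icc 0 T))
    (hR : ∀ k, ∀ t ∈ Icc 0 T, ‖X k t‖ ≤ R) :
    ∃ (κ : ℕ → ℕ) (Y : ℝ → W), StrictMono κ ∧ LipschitzOnWith L Y (Icc 0 T) ∧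
      TendstoUniformlyOn (fun j => X (κ j)) Y atTop (Icc 0 T) := by
  let F : ℕ → BoundedContinuousFunction (Icc (0 : ℝ) T) W := fun k =>
    BoundedContinuousFunction.mkOfCompact
      ⟨(Icc 0 T).domRestrict (X k), continuousOn_iff_continuous_domRestrict.1 (hX k).continuousOn⟩
  have hF : ∀ k (t : Icc (0 : ℝ) T), F k t = X k t := fun k t => rfl
  have hFL : ∀ k, LipschitzWith L (F k) := fun k =>
    LipschitzWith.of_dist_le_mul fun s t => (hX k).dist_le_mul s s.2 t t.2
  have : ProperSpace W := FiniteDimensional.proper ℝ W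
  have hcomp : IsCompact (closure (range F)) := by
    refine BoundedContinuousFunction.arzela_ascoli (Metric.closedBall (0 : W) R)
      (isCompact_closedBall 0 R) _ ?_ ?_
    · rintro _ t ⟨k, rfl⟩
      rw [hF, mem_closedBall_zero_iff]
      exact hR k t t.2
    · refine (LipschitzWith.uniformEquicontinuous _ L ?_).equicontinuous
      rintro ⟨_, k, rfl⟩
      exact hFL k
  obtain ⟨G, -, κ, hκ, hG⟩ := hcomp.tendsto_subseq (x := F)
    (fun k => subset_closure (mem_range_self k))
  have hunif := BoundedContinuousFunction.tendsto_iff_tendstoUniformly.1 hG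
  have hY : TendstoUniformlyOn (fun j => X (κ j)) (IccExtend hT G) atTop (Icc 0 T) := by
    rw [Metric.tendstoUniformlyOn_iff]
    intro ε hε
    filter_upwards [Metric.tendstoUniformly_iff.1 hunif ε hε] with j hj t ht
    have := hj ⟨t, ht⟩
    rwa [IccExtend_of_mem _ _ ht]
  refine ⟨κ, IccExtend hT G, hκ, ?_, hY⟩
  refine LipschitzOnWith.of_dist_le_mul fun s hs t ht => ?_
  refine le_of_tendsto ((hY.tendsto_at hs).dist (hY.tendsto_at ht)) ?_
  exact Eventually.of_forall fun j => (hX (κ j)).dist_le_mul s hs t ht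

end Calculus

/-! ### Regularity of `ψ`, error bound and uniform boundedness of the moving sets -/

section Constraint

variable {E : Type*} [NormedAddCommGroup E] [InnerProductSpace ℝ E] [CompleteSpace E]

/-- The assumptions on the constraint function `ψ`. -/
structure IsConstraint (T β η : ℝ) (ψ : ℝ → E → ℝ) : Prop where
  pos : 0 < T
  contDiffOn : ContDiffOn ℝ 2 (fun p : ℝ × E => ψ p.1 p.2) (Icc (0 : ℝ) T ×ˢ univ)
  tendsto : ∀ t ∈ Icc (0 : ℝ) T, Tendsto (ψ t) (Bornology.cobounded E) atTop
  beta_pos : 0 < β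
  eta_pos : 0 < η
  lt_norm_gradient : ∀ t ∈ Icc (0 : ℝ) T, ∀ x, -β ≤ ψ t x → η < ‖gradient (ψ t) x‖

namespace IsConstraint

variable {T β η : ℝ} {ψ : ℝ → E → ℝ} (h : IsConstraint T β η ψ)

include h

lemma hasFDerivWithinAt {t : ℝ} (ht : t ∈ Icc 0 T) (x : E) :
    HasFDerivWithinAt (fun p : ℝ × E => ψ p.1 p.2)
      (fderivWithin ℝ (fun p : ℝ × E => ψ p.1 p.2) (Icc (0 : ℝ) T ×ˢ univ) (t, x))
      (Icc (0 : ℝ) T ×ˢ univ) (t, x) :=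
  (h.contDiffOn.differentiableOn (by norm_num) (t, x) ⟨ht, mem_univ _⟩).hasFDerivWithinAt

lemma uniqueDiffOn : UniqueDiffOn ℝ (Icc (0 : ℝ) T ×ˢ (univ : Set E)) :=
  (uniqueDiffOn_Icc h.pos).prod uniqueDiffOn_univ

lemma contDiffOn_fderivWithin :
    ContDiffOn ℝ 1 (fderivWithin ℝ (fun p : ℝ × E => ψ p.1 p.2) (Icc (0 : ℝ) T ×ˢ univ))
      (Icc (0 : ℝ) T ×ˢ univ) :=
  h.contDiffOn.fderivWithin h.uniqueDiffOn (by norm_num)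

/-- `ψ` is smooth only on the closed time strip, but directions `(0, v)` never leave the strip, so
the derivative within it gives a full derivative in `x`. -/
lemma hasFDerivAt_section {t : ℝ} (ht : t ∈ Icc 0 T) (x : E) :
    HasFDerivAt (ψ t)
      ((fderivWithin ℝ (fun p : ℝ × E => ψ p.1 p.2) (Icc (0 : ℝ) T ×ˢ univ) (t, x)).comp
        (ContinuousLinearMap.inr ℝ ℝ E)) x := by
  rw [← hasFDerivWithinAt_univ]
  exact (h.hasFDerivWithinAt ht x).comp (t := Icc (0 : ℝ) T ×ˢ univ) x
    (hasFDerivAt_prodMk_right t x).hasFDerivWithinAt (fun y _ => ⟨ht, mem_univ _⟩)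

lemma gradient_eq {t : ℝ} (ht : t ∈ Icc 0 T) (x : E) :
    gradient (ψ t) x = (InnerProductSpace.toDual ℝ E).symm
      ((fderivWithin ℝ (fun p : ℝ × E => ψ p.1 p.2) (Icc (0 : ℝ) T ×ˢ univ) (t, x)).comp
        (ContinuousLinearMap.inr ℝ ℝ E)) := by
  rw [gradient, (h.hasFDerivAt_section ht x).fderiv]

lemma hasGradientAt {t : ℝ} (ht : t ∈ Icc 0 T) (x : E) :
    HasGradientAt (ψ t) (gradient (ψ t) x) x :=
  (h.hasFDerivAt_section ht x).differentiableAt.hasGradientAt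

lemma continuousOn : ContinuousOn (fun p : ℝ × E => ψ p.1 p.2) (Icc (0 : ℝ) T ×ˢ univ) :=
  h.contDiffOn.continuousOn

lemma continuous_section {t : ℝ} (ht : t ∈ Icc 0 T) : Continuous (ψ t) :=
  continuous_iff_continuousAt.2 fun x => (h.hasFDerivAt_section ht x).continuousAt

lemma continuousOn_gradient :
    ContinuousOn (fun p : ℝ × E => gradient (ψ p.1) p.2) (Icc (0 : ℝ) T ×ˢ univ) := by
  have h1 : ContinuousOn (fun p : ℝ × E => (InnerProductSpace.toDual ℝ E).symm
      ((fderivWithin ℝ (fun p : ℝ × E => ψ p.1 p.2) (Icc (0 : ℝ) T ×ˢ univ) p).comp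
        (ContinuousLinearMap.inr ℝ ℝ E))) (Icc (0 : ℝ) T ×ˢ univ) :=
    (InnerProductSpace.toDual ℝ E).symm.continuous.comp_continuousOn
      (h.contDiffOn_fderivWithin.continuousOn.clm_comp continuousOn_const)
  exact h1.congr fun p hp => h.gradient_eq hp.1 p.2

lemma continuous_gradient {t : ℝ} (ht : t ∈ Icc 0 T) : Continuous (gradient (ψ t)) :=
  h.continuousOn_gradient.comp_continuous (f := fun x : E => (t, x)) (by fun_prop)
    fun x => ⟨ht, mem_univ _⟩

lemma continuousOn_comp {x : ℝ → E} (hx : ContinuousOn x (Icc 0 T)) :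
    ContinuousOn (fun t => ψ t (x t)) (Icc 0 T) :=
  h.continuousOn.comp (continuousOn_id.prodMk hx) fun _ ht => ⟨ht, mem_univ _⟩

lemma continuousOn_gradient_comp {x : ℝ → E} (hx : ContinuousOn x (Icc 0 T)) :
    ContinuousOn (fun t => gradient (ψ t) (x t)) (Icc 0 T) :=
  h.continuousOn_gradient.comp (continuousOn_id.prodMk hx) fun _ ht => ⟨ht, mem_univ _⟩

/-- Chain rule along a curve. -/
lemma hasDerivAt_comp {t : ℝ} (ht : t ∈ Ioo 0 T) {x : ℝ → E} {v : E} (hx : HasDerivAt x v t) :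
    HasDerivAt (fun s => ψ s (x s))
      (derivWithin (fun s => ψ s (x t)) (Icc 0 T) t + inner ℝ (gradient (ψ t) (x t)) v) t := by
  have ht' := Ioo_subset_Icc_self ht
  set D := fderivWithin ℝ (fun p : ℝ × E => ψ p.1 p.2) (Icc (0 : ℝ) T ×ˢ univ) (t, x t) with hD
  have h1 : HasDerivWithinAt (fun s => ψ s (x t)) (D (1, 0)) (Icc 0 T) t :=
    (h.hasFDerivWithinAt ht' (x t)).comp_hasDerivWithinAt t
      (f := fun s => (s, x t)) ((hasDerivWithinAt_id t _).prodMk (hasDerivWithinAt_const t _ _))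
      (fun s hs => ⟨hs, mem_univ _⟩)
  have h2 : HasDerivWithinAt (fun s => ψ s (x s)) (D (1, v)) (Icc 0 T) t :=
    (h.hasFDerivWithinAt ht' (x t)).comp_hasDerivWithinAt t
      (f := fun s => (s, x s)) ((hasDerivWithinAt_id t _).prodMk hx.hasDerivWithinAt)
      (fun s hs => ⟨hs, mem_univ _⟩)
  have h3 : inner ℝ (gradient (ψ t) (x t)) v = D (0, v) := by
    rw [h.gradient_eq ht', InnerProductSpace.toDual_symm_apply]
    simp [hD]
  rw [h1.derivWithin (uniqueDiffOn_Icc h.pos t ht'), h3, ← map_add]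
  simpa using h2.hasDerivAt (Icc_mem_nhds ht.1 ht.2)

variable [FiniteDimensional ℝ E]

lemma exists_lipschitzOnWith (R : ℝ) : ∃ K, LipschitzOnWith K (fun p : ℝ × E => ψ p.1 p.2)
    (Icc (0 : ℝ) T ×ˢ Metric.closedBall 0 R) := by
  have : ProperSpace E := FiniteDimensional.proper ℝ E
  exact (h.contDiffOn.mono (prod_mono_right (subset_univ _))).exists_lipschitzOnWith (by norm_num)
    ((convex_Icc 0 T).prod (convex_closedBall 0 R)) (isCompact_Icc.prod (isCompact_closedBall 0 R))

/-- A `C¹` map is Lipschitz on compact convex sets; applied to the derivative of `ψ`, this gives a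
constant uniform in time, the source of the quadratic error in the normal inequality. -/
lemma exists_gradient_lipschitz (R : ℝ) : ∃ K : ℝ, 0 ≤ K ∧ ∀ t ∈ Icc 0 T, ∀ x y : E, ‖x‖ ≤ R →
    ‖y‖ ≤ R → ‖gradient (ψ t) x - gradient (ψ t) y‖ ≤ K * ‖x - y‖ := by
  have : ProperSpace E := FiniteDimensional.proper ℝ E
  obtain ⟨K, hK⟩ := (h.contDiffOn_fderivWithin.mono
    (prod_mono_right (subset_univ (Metric.closedBall (0 : E) R)))).exists_lipschitzOnWith (by norm_num)
    ((convex_Icc 0 T).prod (convex_closedBall 0 R)) (isCompact_Icc.prod (isCompact_closedBall 0 R))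
  refine ⟨K, K.2, fun t ht x y hx hy => ?_⟩
  rw [h.gradient_eq ht, h.gradient_eq ht, ← map_sub, LinearIsometryEquiv.norm_map,
    ← ContinuousLinearMap.sub_comp]
  have h1 := hK.dist_le_mul (t, x) ⟨ht, by simpa using hx⟩ (t, y) ⟨ht, by simpa using hy⟩
  rw [dist_eq_norm, Prod.dist_eq, dist_self, max_eq_right dist_nonneg, dist_eq_norm] at h1
  refine le_trans ?_ h1
  refine (ContinuousLinearMap.opNorm_comp_le _ _).trans ?_
  exact mul_le_of_le_one_right (norm_nonneg _) (ContinuousLinearMap.norm_inr_le_one ℝ ℝ E)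

lemma exists_norm_gradient_le (R : ℝ) : ∃ G : ℝ, 0 ≤ G ∧ ∀ t ∈ Icc 0 T, ∀ x : E, ‖x‖ ≤ R →
    ‖gradient (ψ t) x‖ ≤ G := by
  have : ProperSpace E := FiniteDimensional.proper ℝ E
  obtain ⟨G, hG⟩ := ((isCompact_Icc (a := (0 : ℝ)) (b := T)).prod
    (isCompact_closedBall (0 : E) R)).exists_bound_of_continuousOn
    (h.continuousOn_gradient.mono (prod_mono_right (subset_univ _)))
  exact ⟨max G 0, le_max_right _ _, fun t ht x hx =>
    (hG (t, x) ⟨ht, by simpa using hx⟩).trans (le_max_left _ _)⟩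

lemma exists_lipschitzOnWith_comp {x : ℝ → E} {L : NNReal} (hx : LipschitzOnWith L x (Icc 0 T)) :
    ∃ K, LipschitzOnWith K (fun t => ψ t (x t)) (Icc 0 T) := by
  obtain ⟨R, hR⟩ := isCompact_Icc.exists_bound_of_continuousOn hx.continuousOn
  obtain ⟨K, hK⟩ := h.exists_lipschitzOnWith R
  have h1 : LipschitzOnWith (max 1 L) (fun t => (t, x t)) (Icc 0 T) :=
    (LipschitzWith.id.lipschitzOnWith).prodMk hx
  exact ⟨_, hK.comp h1 fun t ht => ⟨ht, by simpa using hR t ht⟩⟩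

omit [FiniteDimensional ℝ E] in
/-- Second order Taylor estimate. -/
lemma abs_sub_sub_inner_le {K R : ℝ} (hK0 : 0 ≤ K) {t : ℝ} (ht : t ∈ Icc 0 T)
    (hK : ∀ x y : E, ‖x‖ ≤ R → ‖y‖ ≤ R →
      ‖gradient (ψ t) x - gradient (ψ t) y‖ ≤ K * ‖x - y‖)
    {x y : E} (hx : ‖x‖ ≤ R) (hy : ‖y‖ ≤ R) :
    |ψ t y - ψ t x - inner ℝ (gradient (ψ t) x) (y - x)| ≤ K * ‖y - x‖ ^ 2 := by
  have h1 := ((convex_closedBall (0 : E) R).inter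
    (convex_closedBall x ‖y - x‖)).norm_image_sub_le_of_norm_hasFDerivWithin_le'
    (f := ψ t) (C := K * ‖y - x‖) (φ := InnerProductSpace.toDual ℝ E (gradient (ψ t) x))
    (fun z _ => (h.hasGradientAt ht z).hasFDerivAt.hasFDerivWithinAt)
    (fun z hz => by
      rw [← map_sub, LinearIsometryEquiv.norm_map]
      refine (hK z x (by simpa using hz.1) hx).trans ?_
      have := hz.2
      rw [Metric.mem_closedBall, dist_eq_norm] at this
      gcongr)
    (x := x) (y := y) ⟨by simpa using hx, by simp⟩
    ⟨by simpa using hy, by simp [dist_eq_norm]⟩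
  rw [InnerProductSpace.toDual_apply_apply, Real.norm_eq_abs] at h1
  linarith [h1, sq ‖y - x‖, mul_assoc K ‖y - x‖ ‖y - x‖]

/-- Error bound: points of a sublevel set are close to lower sublevel sets. -/
lemma exists_le_of_le_add {t : ℝ} (ht : t ∈ Icc 0 T) {a e : ℝ} (ha : -β ≤ a) (he : 0 ≤ e) {x : E}
    (hx : ψ t x ≤ a + e) : ∃ z, ψ t z ≤ a ∧ ‖z - x‖ ≤ e / η := by
  have : ProperSpace E := FiniteDimensional.proper ℝ E
  have hη := h.eta_pos
  rcases le_or_gt (ψ t x) a with hxa | hxa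
  · exact ⟨x, hxa, by simpa using by positivity⟩
  have hcont := h.continuous_section ht
  have hclosed : IsClosed {z | a ≤ ψ t z} := isClosed_le continuous_const hcont
  -- Minimize `ψ + η‖· - x‖` over `{ψ ≥ a}`; coercivity provides a minimizer `z`. If `ψ(z) = a`,
  -- comparison with `x` gives the distance estimate.
  have hgc : Continuous (fun z => ψ t z + η * ‖z - x‖) := by fun_prop
  obtain ⟨z, hz, hmin⟩ := hgc.continuousOn.exists_isMinOn' (s := {z | a ≤ ψ t z})
    hclosed (x₀ := x) hxa.le (by
      rw [← Metric.cobounded_eq_cocompact]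
      have h1 := (h.tendsto t ht).eventually_ge_atTop (ψ t x + η * ‖x - x‖)
      refine mem_inf_of_left ?_
      filter_upwards [h1] with z hz
      have : 0 ≤ η * ‖z - x‖ := by positivity
      linarith)
  have hle : ψ t z + η * ‖z - x‖ ≤ ψ t x := by simpa using hmin hxa.le
  rcases (show a ≤ ψ t z from hz).eq_or_lt with heq | hlt
  · refine ⟨z, heq.ge, ?_⟩
    rw [le_div_iff₀ hη]
    linarith
  · exfalso
    have hloc : ∀ᶠ w in 𝓝 z, ψ t z ≤ ψ t w + η * ‖w - z‖ := by
      filter_upwards [hcont.continuousAt.eventually (lt_mem_nhds hlt)] with w hw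
      have h1 : ψ t z + η * ‖z - x‖ ≤ ψ t w + η * ‖w - x‖ := hmin (show a ≤ ψ t w from hw.le)
      have h2 : ‖w - x‖ ≤ ‖w - z‖ + ‖z - x‖ := norm_sub_le_norm_sub_add_norm_sub w z x
      nlinarith
    -- Otherwise `z` is a free local minimizer. Moving along `-g` changes `ψ` at rate `-‖g‖²` and
    -- the distance term by at most `η‖g‖`, which contradicts `‖g‖ > η`.
    set g := gradient (ψ t) z with hg
    have hgη : η < ‖g‖ := h.lt_norm_gradient t ht z (ha.trans hlt.le)
    have hline : HasDerivAt (fun r : ℝ => z - r • g) (-g) 0 := by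
      simpa using ((hasDerivAt_id (0 : ℝ)).smul_const g).const_sub z
    have hd : HasDerivAt (fun r : ℝ => ψ t (z - r • g)) (-‖g‖ ^ 2) 0 := by
      have h1 : HasFDerivAt (ψ t) (InnerProductSpace.toDual ℝ E g) (z - (0 : ℝ) • g) := by
        rw [zero_smul, sub_zero]
        exact (h.hasGradientAt ht z).hasFDerivAt
      have := h1.comp_hasDerivAt (0 : ℝ) hline
      rwa [InnerProductSpace.toDual_apply_apply, inner_neg_right, real_inner_self_eq_norm_sq] at this
    have h3 : Tendsto (fun r : ℝ => r⁻¹ • (ψ t (z - r • g) - ψ t (z - (0 : ℝ) • g))) (𝓝[>] 0)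
        (𝓝 (-‖g‖ ^ 2)) := by
      have := (hasDerivWithinAt_iff_tendsto_slope' (self_notMem_Ioi)).1
        (hd.hasDerivWithinAt (s := Ioi 0))
      simpa [slope_fun_def] using this
    have h4 : -(η * ‖g‖) ≤ -‖g‖ ^ 2 := by
      refine ge_of_tendsto h3 ?_
      have h5 : Tendsto (fun r : ℝ => z - r • g) (𝓝[>] 0) (𝓝 z) := by
        simpa using hline.continuousAt.tendsto.mono_left (nhdsWithin_le_nhds (s := Ioi 0))
      filter_upwards [h5.eventually hloc, self_mem_nhdsWithin] with r hr hr0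
      rw [zero_smul, sub_zero, smul_eq_mul, inv_mul_eq_div, le_div_iff₀ hr0]
      rw [sub_sub_cancel_left, norm_neg, norm_smul, Real.norm_eq_abs, abs_of_pos hr0] at hr
      linarith
    nlinarith [norm_nonneg g]

/-- The error bound from level `η` down to level `0` gives distance at most `η/η = 1`; this makes
the rate bound on `C(t) + B` available wherever `ψ ≤ η`. -/
lemma mem_movingSet_add_closedBall {t : ℝ} (ht : t ∈ Icc 0 T) {x : E} (hx : ψ t x ≤ η) :
    x ∈ movingSet ψ t + Metric.closedBall (0 : E) 1 := by
  have hη := h.eta_pos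
  obtain ⟨z, hz, hzx⟩ := h.exists_le_of_le_add ht (a := 0) (e := η) (by linarith [h.beta_pos])
    h.eta_pos.le (by simpa using hx)
  refine ⟨z, hz, x - z, ?_, by simp⟩
  rw [div_self hη.ne'] at hzx
  rwa [mem_closedBall_zero_iff, norm_sub_rev]

/-- If `|∂ₜψ| ≤ μ` on the moving sets, then they are uniformly bounded. -/
lemma exists_bound {μ : ℝ} (hμ0 : 0 < μ)
    (hμ : ∀ t ∈ Icc (0 : ℝ) T, ∀ x ∈ movingSet ψ t,
      |derivWithin (fun s => ψ s x) (Icc 0 T) t| ≤ μ) :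
    ∃ R, ∀ t ∈ Icc 0 T, ∀ x, ψ t x ≤ η → ‖x‖ ≤ R := by
  have : ProperSpace E := FiniteDimensional.proper ℝ E
  have hη := h.eta_pos
  have hβ := h.beta_pos
  -- A point at depth `β` stays in the moving set for time `β/μ`. As `∂ₜψ` is controlled only on
  -- `C(t)`, the rate is integrated for `ψ` truncated to `[-β, 0]`.
  have le_zero_of_le_neg : ∀ t ∈ Icc 0 T, ∀ s ∈ Icc 0 T, ∀ x, |s - t| < β / μ → ψ t x ≤ -β → ψ s x ≤ 0 := by
    intro t ht s hs x hst hx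
    obtain ⟨K, hK⟩ := h.exists_lipschitzOnWith_comp (x := fun _ => x)
      ((LipschitzWith.const' x (K := 0)).lipschitzOnWith)
    have hq := lipschitzOnWith_trunc hK (-β) 0
    have hL : LipschitzOnWith ⟨μ, hμ0.le⟩ (fun t => max (-β) (min (ψ t x) 0)) (Icc 0 T) := by
      refine lipschitzOnWith_of_ae_hasDerivAt_norm_le
        (absolutelyContinuous_of_lipschitzOnWith h.pos.le hq) h.pos.le ?_
      filter_upwards [ae_differentiableAt_of_lipschitzOnWith hq, ae_restrict_Icc_mem_Ioo 0 T]
        with r hr hr'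
      refine ⟨_, ?_, hr.hasDerivAt⟩
      rcases hasDerivAt_trunc (by linarith)
        (hK.continuousOn.continuousAt (Icc_mem_nhds hr'.1 hr'.2)) hr.hasDerivAt
        with h3 | ⟨h3, h4, h5⟩
      · rw [h3, norm_zero]; exact hμ0.le
      · have h6 := h.hasDerivAt_comp hr' (hasDerivAt_const r x)
        rw [h5.unique h6]
        rw [inner_zero_right, add_zero, Real.norm_eq_abs]
        exact hμ r (Ioo_subset_Icc_self hr') x h4.le
    have h1 := hL.dist_le_mul s hs t ht
    rw [min_eq_left (hx.trans (by linarith)), max_eq_left hx, Real.dist_eq, Real.dist_eq] at h1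
    rw [lt_div_iff₀ hμ0] at hst
    have h2 : max (-β) (min (ψ s x) 0) < 0 := by
      have := le_abs_self (max (-β) (min (ψ s x) 0) - -β)
      have h7 : (max (-β) (min (ψ s x) 0) - -β) ≤ μ * |s - t| := this.trans h1
      linarith
    have h3 : min (ψ s x) 0 < 0 := (le_max_right _ _).trans_lt h2
    by_contra hlt
    push Not at hlt
    rw [min_eq_right hlt.le] at h3
    exact lt_irrefl _ h3
  -- By the error bound, `r` is the distance within which a point of `{ψ ≤ η}` finds one at depth
  -- `β`, hence a point of every `C(s)` with `|s - t| < β/μ`.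
  set r := (η + β) / η with hr
  have hr0 : 0 ≤ r := by positivity
  have exists_near : ∀ t ∈ Icc 0 T, ∀ s ∈ Icc 0 T, |s - t| < β / μ → ∀ x, ψ t x ≤ η →
      ∃ z, ψ s z ≤ 0 ∧ ‖z - x‖ ≤ r := by
    intro t ht s hs hst x hx
    obtain ⟨z, hz, hzx⟩ := h.exists_le_of_le_add ht (a := -β) (e := η + β) le_rfl (by positivity)
      (x := x) (by linarith)
    exact ⟨z, le_zero_of_le_neg t ht s hs z hst hz, hzx⟩
  obtain ⟨R, hR⟩ : ∃ R, ∀ x, ψ 0 x ≤ η → ‖x‖ ≤ R := by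
    have h1 := (h.tendsto 0 ⟨le_rfl, h.pos.le⟩).eventually_gt_atTop η
    have h2 : Bornology.IsBounded {x | ψ 0 x ≤ η} := by
      rw [Bornology.isBounded_def]
      filter_upwards [h1] with x hx
      simpa using hx
    obtain ⟨R, hR⟩ := h2.exists_norm_le
    exact ⟨R, fun x hx => hR x hx⟩
  -- Marching from time `0` in steps of length at most `δ`, each step enlarges the bound by `r`. The
  -- factor `1/2` keeps the steps strictly below `β/μ`.
  set δ := β / μ / 2 with hδ
  have hδ0 : 0 < δ := by positivity
  have norm_le_of_le_mul : ∀ j : ℕ, ∀ t ∈ Icc 0 T, t ≤ j * δ → ∀ x, ψ t x ≤ η → ‖x‖ ≤ R + j * r := by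
    intro j
    induction j with
    | zero =>
      intro t ht htj x hx
      have : t = 0 := le_antisymm (by simpa using htj) ht.1
      subst this
      simpa using hR x hx
    | succ j ih =>
      intro t ht htj x hx
      have hs : max 0 (t - δ) ∈ Icc 0 T :=
        ⟨le_max_left _ _, max_le h.pos.le (by linarith [ht.2])⟩
      have hst : |max 0 (t - δ) - t| < β / μ := by
        rw [abs_lt]
        constructor
        · have := le_max_right 0 (t - δ)
          have : β / μ = 2 * δ := by rw [hδ]; ring
          linarith
        · have : max 0 (t - δ) ≤ t := max_le ht.1 (by linarith)
          have : 0 < β / μ := by positivity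
          linarith
      obtain ⟨z, hz, hzx⟩ := exists_near t ht _ hs hst x hx
      have h1 := ih _ hs (by
        push_cast at htj
        exact max_le (by positivity) (by linarith)) z (by linarith)
      have h2 : ‖x‖ ≤ ‖z‖ + ‖z - x‖ := by
        have := norm_sub_le z (z - x)
        simpa using this
      push_cast
      linarith
  obtain ⟨N, hN⟩ := exists_nat_ge (T / δ)
  rw [div_le_iff₀ hδ0] at hN
  exact ⟨R + N * r, fun t ht x hx => norm_le_of_le_mul N t ht (ht.2.trans hN) x hx⟩

end IsConstraint

end Constraint

/-! ### The normal cone as the ray of the gradient -/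

section NormalCone

variable {E : Type*} [NormedAddCommGroup E] [InnerProductSpace ℝ E] [CompleteSpace E]
  {T β η : ℝ} {ψ : ℝ → E → ℝ}

-- Test the proximal inequality at `s + r d`, divide by `r` and let `r → 0`: the quadratic error
-- disappears.
omit [CompleteSpace E] in
lemma IsProximalNormal.inner_nonpos {S : Set E} {s w d : E} (hw : IsProximalNormal S s w)
    (hd : ∀ᶠ r : ℝ in 𝓝[>] 0, s + r • d ∈ S) : inner ℝ w d ≤ 0 := by
  obtain ⟨-, c, hc, hcS⟩ := hw
  have h1 : Tendsto (fun r : ℝ => c * r * ‖d‖ ^ 2) (𝓝[>] 0) (𝓝 0) := by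
    have : Continuous fun r : ℝ => c * r * ‖d‖ ^ 2 := by fun_prop
    exact (this.tendsto' 0 0 (by simp)).mono_left nhdsWithin_le_nhds
  refine ge_of_tendsto h1 ?_
  filter_upwards [hd, self_mem_nhdsWithin] with r hr hr0
  have := hcS _ hr
  rw [add_sub_cancel_left, inner_smul_right, norm_smul, Real.norm_eq_abs, mul_pow, sq_abs] at this
  have hr0' : (0 : ℝ) < r := hr0
  by_contra hlt
  push Not at hlt
  nlinarith

-- Farkas' lemma for a single vector. Perturbing by `-r g` makes the inequality non-strict; testing
-- `v` against its own component orthogonal to `g` then shows that this component is zero.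
omit [CompleteSpace E] in
lemma eq_smul_of_inner_nonpos {g v : E} (hg : g ≠ 0)
    (h : ∀ d, inner ℝ g d < 0 → inner ℝ v d ≤ 0) : ∃ l : ℝ, 0 ≤ l ∧ v = l • g := by
  have hg2 : 0 < ‖g‖ ^ 2 := by positivity
  have h' : ∀ d, inner ℝ g d ≤ 0 → inner ℝ v d ≤ 0 := by
    intro d hd
    have h1 : Tendsto (fun r : ℝ => inner ℝ v (d - r • g)) (𝓝[>] 0) (𝓝 (inner ℝ v d)) := by
      have : Continuous fun r : ℝ => inner ℝ v (d - r • g) := by fun_prop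
      exact (this.tendsto' 0 _ (by simp)).mono_left nhdsWithin_le_nhds
    refine le_of_tendsto h1 ?_
    filter_upwards [self_mem_nhdsWithin] with r hr
    refine h _ ?_
    rw [inner_sub_right, inner_smul_right, real_inner_self_eq_norm_sq]
    have := mul_pos (show (0 : ℝ) < r from hr) hg2
    linarith
  have hgv : 0 ≤ inner ℝ v g := by
    have := h' (-g) (by rw [inner_neg_right, real_inner_self_eq_norm_sq]; linarith)
    rw [inner_neg_right] at this
    linarith
  refine ⟨inner ℝ v g / ‖g‖ ^ 2, by positivity, ?_⟩
  set l := inner ℝ v g / ‖g‖ ^ 2 with hl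
  have h2 : inner ℝ g (v - l • g) = 0 := by
    rw [inner_sub_right, inner_smul_right, real_inner_self_eq_norm_sq, hl, real_inner_comm]
    field_simp
    ring
  have h3 := h' (v - l • g) h2.le
  have h4 : inner ℝ (v - l • g) (v - l • g) ≤ 0 := by
    rw [inner_sub_left (x := v), inner_smul_left, h2]
    simpa using h3
  exact sub_eq_zero.1 (real_inner_self_nonpos.1 h4)

namespace IsConstraint

variable (h : IsConstraint T β η ψ)

include h

lemma gradient_ne_zero {t : ℝ} (ht : t ∈ Icc 0 T) {x : E} (hx : -β ≤ ψ t x) :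
    gradient (ψ t) x ≠ 0 := by
  rw [← norm_pos_iff]
  exact h.eta_pos.trans (h.lt_norm_gradient t ht x hx)

lemma eventually_mem_movingSet {t : ℝ} (ht : t ∈ Icc 0 T) {p d : E} (hp : ψ t p ≤ 0)
    (hd : ψ t p = 0 → inner ℝ (gradient (ψ t) p) d < 0) :
    ∀ᶠ r : ℝ in 𝓝[>] 0, p + r • d ∈ movingSet ψ t := by
  rcases hp.lt_or_eq with hlt | heq
  · have h1 : Tendsto (fun r : ℝ => ψ t (p + r • d)) (𝓝[>] 0) (𝓝 (ψ t p)) := by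
      have : Continuous fun r : ℝ => ψ t (p + r • d) :=
        (h.continuous_section ht).comp (by fun_prop)
      exact (this.tendsto' 0 _ (by simp)).mono_left nhdsWithin_le_nhds
    filter_upwards [h1.eventually (gt_mem_nhds hlt)] with r hr using hr.le
  · have hline : HasDerivAt (fun r : ℝ => p + r • d) d 0 := by
      simpa using ((hasDerivAt_id (0 : ℝ)).smul_const d).const_add p
    have h1 : HasFDerivAt (ψ t) (InnerProductSpace.toDual ℝ E (gradient (ψ t) p))
        (p + (0 : ℝ) • d) := by
      rw [zero_smul, add_zero]
      exact (h.hasGradientAt ht p).hasFDerivAt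
    have hd1 := h1.comp_hasDerivAt (0 : ℝ) hline
    rw [InnerProductSpace.toDual_apply_apply] at hd1
    have h3 : Tendsto (slope (ψ t ∘ fun r : ℝ => p + r • d) 0) (𝓝[>] 0)
        (𝓝 (inner ℝ (gradient (ψ t) p) d)) :=
      (hasDerivWithinAt_iff_tendsto_slope' (self_notMem_Ioi)).1
        (hd1.hasDerivWithinAt (s := Ioi 0))
    filter_upwards [h3.eventually (gt_mem_nhds (hd heq)), self_mem_nhdsWithin] with r hr hr0
    have hr0' : (0 : ℝ) < r := hr0
    simp only [slope_def_field, Function.comp, zero_smul, add_zero, heq, sub_zero] at hr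
    rw [div_lt_iff₀ hr0', zero_mul] at hr
    exact hr.le

/-- A direction strictly decreasing `ψ` at a boundary point `s` is still so at nearby boundary
points, where proximal normals are nonpositive on it. This survives the limit, and the one-vector
Farkas lemma concludes. If `ψ(s) < 0`, every direction is admissible, in particular `v` itself. -/
lemma exists_smul_of_mem_normalCone {t : ℝ} (ht : t ∈ Icc 0 T) {s v : E}
    (hv : v ∈ normalCone (movingSet ψ t) s) :
    ψ t s ≤ 0 ∧ ∃ l : ℝ, 0 ≤ l ∧ l * ψ t s = 0 ∧ v = l • gradient (ψ t) s := by
  obtain ⟨hs, p, w, hpw, hp, hw⟩ := hv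
  have hs' : ψ t s ≤ 0 := hs
  have key : ∀ d, (ψ t s = 0 → inner ℝ (gradient (ψ t) s) d < 0) → inner ℝ v d ≤ 0 := by
    intro d hd
    refine le_of_tendsto (hw.inner tendsto_const_nhds) ?_
    have h1 : ∀ᶠ i in atTop, ψ t (p i) = 0 → inner ℝ (gradient (ψ t) (p i)) d < 0 := by
      rcases hs'.lt_or_eq with hlt | heq
      · filter_upwards [(((h.continuous_section ht).tendsto s).comp hp).eventually
          (gt_mem_nhds hlt)] with i hi h0
        exact absurd h0 (ne_of_lt hi)
      · filter_upwards [((((h.continuous_gradient ht).tendsto s).comp hp).inner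
          (tendsto_const_nhds (x := d))).eventually (gt_mem_nhds (hd heq))] with i hi _
        exact hi
    filter_upwards [h1] with i hi
    exact (hpw i).inner_nonpos (h.eventually_mem_movingSet ht (hpw i).1 hi)
  refine ⟨hs', ?_⟩
  rcases hs'.lt_or_eq with hlt | heq
  · refine ⟨0, le_rfl, by simp, ?_⟩
    have := key v fun h0 => absurd h0 hlt.ne
    rw [zero_smul]
    exact real_inner_self_nonpos.1 this
  · obtain ⟨l, hl, hvl⟩ := eq_smul_of_inner_nonpos
      (h.gradient_ne_zero ht (by rw [heq]; linarith [h.beta_pos])) fun d hd => key d fun _ => hd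
    exact ⟨l, hl, by simp [heq], hvl⟩

/-- Multiples of the gradient at boundary points are proximal normals to the moving
set, with a uniform constant. -/
lemma smul_gradient_inner_le {K R : ℝ} (hK0 : 0 ≤ K) {t : ℝ} (ht : t ∈ Icc 0 T)
    (hK : ∀ x y : E, ‖x‖ ≤ R → ‖y‖ ≤ R →
      ‖gradient (ψ t) x - gradient (ψ t) y‖ ≤ K * ‖x - y‖)
    {x y : E} (hx : ‖x‖ ≤ R) (hy : ‖y‖ ≤ R) {l : ℝ} (hl : 0 ≤ l) (hlx : l * ψ t x = 0)
    (hy0 : ψ t y ≤ 0) :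
    inner ℝ (l • gradient (ψ t) x) (y - x) ≤ l * K * ‖y - x‖ ^ 2 := by
  have h1 := (abs_le.1 (h.abs_sub_sub_inner_le hK0 ht hK hx hy)).1
  rw [real_inner_smul_left]
  have h2 := mul_le_mul_of_nonneg_left h1 hl
  have h3 := mul_nonpos_of_nonneg_of_nonpos hl hy0
  nlinarith

/-- The multiple is already a proximal normal, so constant sequences suffice; `R` bounds `C(t)`,
which is bounded by coercivity. -/
lemma smul_gradient_mem_normalCone [FiniteDimensional ℝ E] {t : ℝ} (ht : t ∈ Icc 0 T) {s : E}
    (hs : ψ t s ≤ 0) {l : ℝ} (hl : 0 ≤ l) (hls : l * ψ t s = 0) :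
    l • gradient (ψ t) s ∈ normalCone (movingSet ψ t) s := by
  obtain ⟨R, hR⟩ : ∃ R, ∀ x, ψ t x ≤ 0 → ‖x‖ ≤ R := by
    have h2 : Bornology.IsBounded {x | ψ t x ≤ 0} := by
      rw [Bornology.isBounded_def]
      filter_upwards [(h.tendsto t ht).eventually_gt_atTop 0] with x hx
      simpa using hx
    obtain ⟨R, hR⟩ := h2.exists_norm_le
    exact ⟨R, fun x hx => hR x hx⟩
  obtain ⟨K, hK0, hK⟩ := h.exists_gradient_lipschitz R
  exact ⟨hs, fun _ => s, fun _ => l • gradient (ψ t) s, fun _ => ⟨hs, l * K, by positivity,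
    fun y hy => h.smul_gradient_inner_le hK0 ht (hK t ht) (hR s hs) (hR y hy) hl hls hy⟩,
    tendsto_const_nhds, tendsto_const_nhds⟩

end IsConstraint

end NormalCone

/-! ### Bounded multipliers and uniqueness for the sweeping process -/

section Uniqueness

variable {E F : Type*} [NormedAddCommGroup E] [InnerProductSpace ℝ E] [CompleteSpace E]
  {T β η M μ : ℝ} {ψ : ℝ → E → ℝ} {f : ℝ → E → F → E} {U : Set F}

/-- The assumptions on the dynamics `f`. -/
structure IsDynamics [TopologicalSpace F] (T M : ℝ) (f : ℝ → E → F → E) (U : Set F) : Prop where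
  continuousOn : ContinuousOn (fun p : ℝ × E × F => f p.1 p.2.1 p.2.2) (Icc (0 : ℝ) T ×ˢ univ)
  norm_le : ∀ t ∈ Icc (0 : ℝ) T, ∀ x, ∀ u ∈ U, ‖f t x u‖ ≤ M
  lipschitz : ∀ t ∈ Icc (0 : ℝ) T, ∀ u ∈ U, ∀ x y, ‖f t x u - f t y u‖ ≤ M * ‖x - y‖
  convex : ∀ t ∈ Icc (0 : ℝ) T, ∀ x, Convex ℝ ((fun u => f t x u) '' U)
  isCompact : IsCompact U
  pos : 0 < M

/-- The bound relating the data of the problem with the constant `μ`. -/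
def IsRateBound (T μ : ℝ) (f : ℝ → E → F → E) (ψ : ℝ → E → ℝ) (U : Set F) : Prop :=
  ∀ t ∈ Icc (0 : ℝ) T, ∀ u ∈ U, ∀ x ∈ movingSet ψ t + Metric.closedBall (0 : E) 1,
    ‖gradient (ψ t) x‖ * ‖f t x u‖ + |derivWithin (fun s => ψ s x) (Icc 0 T) t| + 1 ≤ μ

omit [CompleteSpace E] [InnerProductSpace ℝ E] in
lemma mem_movingSet_add {t : ℝ} {x : E} (hx : ψ t x ≤ 0) :
    x ∈ movingSet ψ t + Metric.closedBall (0 : E) 1 :=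
  ⟨x, hx, 0, by simp, by simp⟩

namespace IsConstraint

/-- The multiplier form of the inclusion, in which the normal cone no longer appears. -/
lemma isSweepingSolution_iff [FiniteDimensional ℝ E] (h : IsConstraint T β η ψ) {u : ℝ → F}
    {x₀ : E} {x : ℝ → E} :
    IsSweepingSolution T f ψ u x₀ x ↔
      AbsolutelyContinuousOnInterval x 0 T ∧ x 0 = x₀ ∧
      ∀ᵐ t ∂(volume.restrict (Icc (0 : ℝ) T)), ψ t (x t) ≤ 0 ∧ ∃ l : ℝ, 0 ≤ l ∧
        l * ψ t (x t) = 0 ∧ HasDerivAt x (f t (x t) (u t) - l • gradient (ψ t) (x t)) t := by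
  refine and_congr_right fun _ => and_congr_right fun _ => ⟨fun hx => ?_, fun hx => ?_⟩
  · filter_upwards [hx, ae_restrict_mem measurableSet_Icc] with t ht htT
    obtain ⟨v, hv, hd⟩ := ht
    obtain ⟨_, rfl, n, hn, rfl⟩ := hv
    obtain ⟨h1, l, hl, hl', rfl⟩ := h.exists_smul_of_mem_normalCone htT hn
    exact ⟨h1, l, hl, hl', hd⟩
  · filter_upwards [hx, ae_restrict_mem measurableSet_Icc] with t ht htT
    obtain ⟨h1, l, hl, hl', hd⟩ := ht
    exact ⟨_, ⟨_, rfl, _, h.smul_gradient_mem_normalCone htT h1 hl hl', rfl⟩, hd⟩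

/-- A continuous curve lying in the moving sets for almost every time does so at every time. -/
lemma le_zero_of_ae (h : IsConstraint T β η ψ) {x : ℝ → E} (hx : ContinuousOn x (Icc 0 T))
    (hae : ∀ᵐ t ∂(volume.restrict (Icc (0 : ℝ) T)), ψ t (x t) ≤ 0) :
    ∀ t ∈ Icc 0 T, ψ t (x t) ≤ 0 := by
  have hc := h.continuousOn_comp hx
  have h1 : EqOn (fun t => max (ψ t (x t)) 0) (fun _ => 0) (Icc 0 T) :=
    Measure.eqOn_Icc_of_ae_eq volume h.pos.ne
      (by filter_upwards [hae] with t ht using max_eq_right ht)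
      (hc.sup continuousOn_const) continuousOn_const
  intro t ht
  exact max_eq_right_iff.1 (h1 ht)

/-- The multiplier of a sweeping solution is bounded. -/
lemma multiplier_le (h : IsConstraint T β η ψ) {x : ℝ → E}
    (hx : ∀ t ∈ Icc 0 T, ψ t (x t) ≤ 0) {t : ℝ} (ht : t ∈ Ioo 0 T) {w : E} {l : ℝ}
    (hl : 0 ≤ l) (hlx : l * ψ t (x t) = 0) (hd : HasDerivAt x (w - l • gradient (ψ t) (x t)) t)
    (hμ : ‖gradient (ψ t) (x t)‖ * ‖w‖ + |derivWithin (fun s => ψ s (x t)) (Icc 0 T) t| + 1 ≤ μ) :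
    l ≤ μ / η ^ 2 := by
  have hη := h.eta_pos
  have hμ0 : 0 ≤ μ := le_trans (by positivity) hμ
  rcases hl.eq_or_lt with rfl | hl0
  · positivity
  have h0 : ψ t (x t) = 0 := by
    rcases mul_eq_zero.1 hlx with h1 | h1
    · exact absurd h1 hl0.ne'
    · exact h1
  -- At an active time `ψ(s,x(s)) ≤ 0` is attained with equality, so its derivative vanishes:
  -- `l‖∇ψ‖² = ∂ₜψ + ⟨∇ψ, w⟩ ≤ μ`.
  have hmax : IsLocalMax (fun s => ψ s (x s)) t := by
    filter_upwards [Icc_mem_nhds ht.1 ht.2] with s hs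
    rw [h0]
    exact hx s hs
  have h1 := hmax.hasDerivAt_eq_zero (h.hasDerivAt_comp ht hd)
  rw [inner_sub_right, inner_smul_right, real_inner_self_eq_norm_sq] at h1
  have hg := h.lt_norm_gradient t (Ioo_subset_Icc_self ht) (x t) (by rw [h0]; linarith [h.beta_pos])
  have h2 := real_inner_le_norm (gradient (ψ t) (x t)) w
  have h3 := le_abs_self (derivWithin (fun s => ψ s (x t)) (Icc 0 T) t)
  rw [le_div_iff₀ (by positivity)]
  have h4 : η ^ 2 ≤ ‖gradient (ψ t) (x t)‖ ^ 2 := by gcongr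
  nlinarith

variable [TopologicalSpace F] [MeasurableSpace F] [FiniteDimensional ℝ E]

/-- Properties of sweeping solutions: they are Lipschitz and have bounded multipliers. -/
lemma sweeping_properties (h : IsConstraint T β η ψ) (hf : IsDynamics T M f U)
    (hμ : IsRateBound T μ f ψ U) {u : ℝ → F} (hu : IsControl T U u) {x₀ : E} {x : ℝ → E}
    (hx : IsSweepingSolution T f ψ u x₀ x) :
    (∀ t ∈ Icc 0 T, ψ t (x t) ≤ 0) ∧ (∃ L, LipschitzOnWith L x (Icc 0 T)) ∧
    ∀ᵐ t ∂(volume.restrict (Icc (0 : ℝ) T)), ∃ l : ℝ, 0 ≤ l ∧ l ≤ μ / η ^ 2 ∧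
        l * ψ t (x t) = 0 ∧ HasDerivAt x (f t (x t) (u t) - l • gradient (ψ t) (x t)) t := by
  have hη := h.eta_pos
  obtain ⟨hac, -, hx⟩ := h.isSweepingSolution_iff.1 hx
  have hcont : ContinuousOn x (Icc 0 T) := by simpa [uIcc_of_le h.pos.le] using hac.continuousOn
  have hC := h.le_zero_of_ae hcont (hx.mono fun t ht => ht.1)
  have hl : ∀ᵐ t ∂(volume.restrict (Icc (0 : ℝ) T)), ∃ l : ℝ, 0 ≤ l ∧ l ≤ μ / η ^ 2 ∧
      l * ψ t (x t) = 0 ∧ HasDerivAt x (f t (x t) (u t) - l • gradient (ψ t) (x t)) t := by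
    filter_upwards [hx, ae_restrict_Icc_mem_Ioo 0 T, hu.2] with t ht htT hut
    obtain ⟨h1, l, hl0, hlx, hd⟩ := ht
    exact ⟨l, hl0, h.multiplier_le hC htT hl0 hlx hd
      (hμ t (Ioo_subset_Icc_self htT) _ hut _ (mem_movingSet_add h1)), hlx, hd⟩
  refine ⟨hC, ?_, hl⟩
  obtain ⟨G, hG⟩ := isCompact_Icc.exists_bound_of_continuousOn (h.continuousOn_gradient_comp hcont)
  refine ⟨Real.toNNReal (M + μ / η ^ 2 * G), lipschitzOnWith_of_ae_hasDerivAt_norm_le hac h.pos.le ?_⟩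
  filter_upwards [hl, ae_restrict_mem measurableSet_Icc, hu.2] with t ht htT hut
  obtain ⟨l, hl0, hl1, -, hd⟩ := ht
  refine ⟨_, le_trans ?_ (Real.le_coe_toNNReal _), hd⟩
  refine (norm_sub_le _ _).trans (add_le_add (hf.norm_le t htT _ _ hut) ?_)
  rw [norm_smul, Real.norm_eq_abs, abs_of_nonneg hl0]
  exact mul_le_mul hl1 (hG t htT) (norm_nonneg _) (hl0.trans hl1)

/-- Uniqueness for the controlled sweeping process. -/
theorem sweeping_unique (h : IsConstraint T β η ψ) (hf : IsDynamics T M f U)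
    (hμ : IsRateBound T μ f ψ U) {u : ℝ → F} (hu : IsControl T U u) {x₀ : E} {y z : ℝ → E}
    (hy : IsSweepingSolution T f ψ u x₀ y) (hz : IsSweepingSolution T f ψ u x₀ z) :
    EqOn y z (Icc 0 T) := by
  obtain ⟨hCy, ⟨Ly, hLy⟩, hdy⟩ := h.sweeping_properties hf hμ hu hy
  obtain ⟨hCz, ⟨Lz, hLz⟩, hdz⟩ := h.sweeping_properties hf hμ hu hz
  obtain ⟨R₁, hR₁⟩ := isCompact_Icc.exists_bound_of_continuousOn hLy.continuousOn
  obtain ⟨R₂, hR₂⟩ := isCompact_Icc.exists_bound_of_continuousOn hLz.continuousOn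
  set R := max R₁ R₂
  obtain ⟨K, hK0, hK⟩ := h.exists_gradient_lipschitz R
  have hnsq : ∃ L, LipschitzOnWith L (fun t => ‖y t - z t‖ ^ 2) (Icc 0 T) := by
    obtain ⟨L, hL⟩ := (contDiff_norm_sq ℝ (E := E) (n := 1)).contDiffOn.exists_lipschitzOnWith
      (by norm_num) (convex_closedBall (0 : E) (R₁ + R₂))
      (by have : ProperSpace E := FiniteDimensional.proper ℝ E
          exact isCompact_closedBall (0 : E) (R₁ + R₂))
    exact ⟨_, hL.comp (hLy.sub hLz) fun t ht => by
      simpa using (norm_sub_le _ _).trans (add_le_add (hR₁ t ht) (hR₂ t ht))⟩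
  obtain ⟨L, hL⟩ := hnsq
  -- In the constant, `M` comes from the Lipschitz bound on `f`, each of the two normal terms
  -- contributes `(μ/η²)K`, and the outer `2` comes from differentiating the square.
  have hq := nonpos_of_ae_hasDerivAt_le_mul (C := 2 * (M + 2 * (μ / η ^ 2) * K)) hL
    (by simp [hy.2.1, hz.2.1]) (by
      filter_upwards [hdy, hdz, ae_restrict_mem measurableSet_Icc, hu.2] with t hty htz htT hut
      obtain ⟨l, hl0, hl1, hlx, hd⟩ := hty
      obtain ⟨l', hl0', hl1', hlx', hd'⟩ := htz
      refine ⟨_, (hd.sub hd').norm_sq, ?_⟩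
      have hyR : ‖y t‖ ≤ R := (hR₁ t htT).trans (le_max_left _ _)
      have hzR : ‖z t‖ ≤ R := (hR₂ t htT).trans (le_max_right _ _)
      have e1 := h.smul_gradient_inner_le hK0 htT (hK t htT) hyR hzR hl0 hlx (hCz t htT)
      have e2 := h.smul_gradient_inner_le hK0 htT (hK t htT) hzR hyR hl0' hlx' (hCy t htT)
      have e3 := (real_inner_le_norm (y t - z t) (f t (y t) (u t) - f t (z t) (u t))).trans
        (mul_le_mul_of_nonneg_left (hf.lipschitz t htT _ hut (y t) (z t)) (norm_nonneg _))
      have e4 : l * K * ‖y t - z t‖ ^ 2 ≤ μ / η ^ 2 * K * ‖y t - z t‖ ^ 2 := by gcongr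
      have e5 : l' * K * ‖y t - z t‖ ^ 2 ≤ μ / η ^ 2 * K * ‖y t - z t‖ ^ 2 := by gcongr
      rw [norm_sub_rev (z t), ← neg_sub (y t) (z t), inner_neg_right, real_inner_comm] at e1
      rw [real_inner_comm] at e2
      have e6 : f t (y t) (u t) - l • gradient (ψ t) (y t) -
          (f t (z t) (u t) - l' • gradient (ψ t) (z t)) =
          (f t (y t) (u t) - f t (z t) (u t)) - l • gradient (ψ t) (y t) +
            l' • gradient (ψ t) (z t) := by abel
      simp only [Pi.sub_apply]
      rw [e6, inner_add_right, inner_sub_right]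
      nlinarith)
  intro t ht
  have h1 := hq t ht
  have h2 : ‖y t - z t‖ ^ 2 = 0 := le_antisymm h1 (by positivity)
  exact sub_eq_zero.1 (norm_eq_zero.1 (pow_eq_zero_iff (two_ne_zero)|>.1 h2))

end IsConstraint

end Uniqueness

/-! ### The penalty multiplier and invariance of the enlarged sets -/

section Penalization

/-- The penalty multiplier `γ exp(γ(r - σ))`. -/
noncomputable def penaltyMultiplier (σ γ r : ℝ) : ℝ := γ * Real.exp (γ * (r - σ))

/-- Explains the choice of `μ_k`: at this level the penalty multiplier has exactly the value that
bounds the exact multipliers. -/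
lemma penaltyMultiplier_at_level {μ η γ : ℝ} (σ : ℝ) (hμ : 0 < μ) (hη : 0 < η) (hγ : 0 < γ) :
    penaltyMultiplier σ γ (σ + penaltyLevel μ η γ) = μ / η ^ 2 := by
  have h1 : γ * (σ + penaltyLevel μ η γ - σ) = Real.log (μ / (η ^ 2 * γ)) := by
    unfold penaltyLevel
    field_simp
    ring
  rw [penaltyMultiplier, h1, Real.exp_log (by positivity)]
  field_simp

lemma continuous_penaltyMultiplier (σ γ : ℝ) : Continuous (penaltyMultiplier σ γ) := by
  unfold penaltyMultiplier
  fun_prop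

lemma penaltyMultiplier_mono {σ γ r s : ℝ} (hγ : 0 < γ) (hrs : r ≤ s) :
    penaltyMultiplier σ γ r ≤ penaltyMultiplier σ γ s := by
  unfold penaltyMultiplier
  gcongr

lemma penaltyMultiplier_nonneg {σ γ : ℝ} (r : ℝ) (hγ : 0 < γ) : 0 ≤ penaltyMultiplier σ γ r :=
  (mul_pos hγ (Real.exp_pos _)).le

/-- The level is `(log(μ/η²) - log γ)/γ`, and `log γ` is negligible against `γ`. -/
lemma tendsto_penaltyLevel {μ η : ℝ} (hμ : 0 < μ) (hη : 0 < η) {γ : ℕ → ℝ}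
    (hγ : Tendsto γ atTop atTop) : Tendsto (fun k => penaltyLevel μ η (γ k)) atTop (𝓝 0) := by
  have h1 : Tendsto (fun x : ℝ => Real.log x / x) atTop (𝓝 0) := by
    simpa using Real.tendsto_pow_log_div_mul_add_atTop 1 0 1 one_ne_zero
  have h2 : Tendsto (fun x : ℝ => Real.log (μ / η ^ 2) / x - Real.log x / x) atTop (𝓝 0) := by
    simpa using (tendsto_const_nhds.div_atTop tendsto_id).sub h1
  refine (h2.comp hγ).congr' ?_
  filter_upwards [hγ.eventually_gt_atTop 0] with k hk
  simp only [Function.comp, penaltyLevel]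
  rw [← div_div, Real.log_div (by positivity) hk.ne']
  ring

/-- At negative levels of the constraint function the multipliers tend to zero. -/
lemma tendsto_penaltyMultiplier {σ γ : ℕ → ℝ} (hσ : Tendsto σ atTop (𝓝 0))
    (hγ : Tendsto γ atTop atTop) {c : ℝ} (hc : c < 0) :
    Tendsto (fun k => penaltyMultiplier (σ k) (γ k) c) atTop (𝓝 0) := by
  have h1 : Tendsto (fun x : ℝ => x * Real.exp (-(-c / 2) * x)) atTop (𝓝 0) := by
    simpa using tendsto_rpow_mul_exp_neg_mul_atTop_nhds_zero 1 (-c / 2) (by linarith)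
  refine squeeze_zero' ?_ ?_ (h1.comp hγ)
  · filter_upwards [hγ.eventually_gt_atTop 0] with k hk using penaltyMultiplier_nonneg _ hk
  -- Once `σ > c/2`, the exponent `γ(c - σ)` is below `γc/2`, and exponential decay beats the factor
  -- `γ`.
  · filter_upwards [hγ.eventually_gt_atTop 0, hσ.eventually (lt_mem_nhds (show c / 2 < 0 by linarith))]
      with k hk hk'
    simp only [Function.comp, penaltyMultiplier]
    refine mul_le_mul_of_nonneg_left (Real.exp_le_exp.2 ?_) hk.le
    nlinarith

variable {E F : Type*} [NormedAddCommGroup E] [InnerProductSpace ℝ E] [CompleteSpace E]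
  [FiniteDimensional ℝ E] [TopologicalSpace F] [MeasurableSpace F]
  {T β η M μ : ℝ} {ψ : ℝ → E → ℝ} {f : ℝ → E → F → E} {U : Set F}

namespace IsConstraint

omit [TopologicalSpace F] in
/-- Invariance of the enlarged sets under the penalized dynamics. -/
lemma mem_enlargedSet_of_penalized (h : IsConstraint T β η ψ) (hμ : IsRateBound T μ f ψ U)
    {σ γ : ℝ} (hγ : 0 < γ) (hμ0 : 0 < μ) (he : -β ≤ σ + penaltyLevel μ η γ)
    (he' : σ + penaltyLevel μ η γ < η) {u : ℝ → F} (hu : IsControl T U u) {x : ℝ → E}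
    (hx : ∃ L, LipschitzOnWith L x (Icc 0 T)) (h0 : ψ 0 (x 0) ≤ σ + penaltyLevel μ η γ)
    (hd : ∀ᵐ t ∂(volume.restrict (Icc (0 : ℝ) T)), ψ t (x t) ≤ η → HasDerivAt x
      (f t (x t) (u t) - penaltyMultiplier σ γ (ψ t (x t)) • gradient (ψ t) (x t)) t) :
    ∀ t ∈ Icc 0 T, ψ t (x t) ≤ σ + penaltyLevel μ η γ := by
  have hη := h.eta_pos
  obtain ⟨L, hL⟩ := hx
  obtain ⟨K, hK⟩ := h.exists_lipschitzOnWith_comp hL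
  -- In the strip between the level and `η`, the derivative of `ψ(t,x(t))` is at most `(μ - 1) - μ <
  -- 0`. Only the equation inside `{ψ ≤ η}` enters, so the lemma also covers equations modified
  -- outside that set.
  refine le_of_ae_hasDerivAt_nonpos_of_mem he' hK h0 ?_
  filter_upwards [hd, ae_restrict_Icc_mem_Ioo 0 T, hu.2] with t ht htT hut h1 h2 d hdt
  have htT' := Ioo_subset_Icc_self htT
  rw [hdt.unique (h.hasDerivAt_comp htT (ht h2.le)), inner_sub_right, inner_smul_right,
    real_inner_self_eq_norm_sq]
  have hb := hμ t htT' _ hut (x t) (h.mem_movingSet_add_closedBall htT' h2.le)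
  have hg := h.lt_norm_gradient t htT' (x t) (he.trans h1.le)
  have e1 := real_inner_le_norm (gradient (ψ t) (x t)) (f t (x t) (u t))
  have e2 := le_abs_self (derivWithin (fun s => ψ s (x t)) (Icc 0 T) t)
  have e3 : μ / η ^ 2 ≤ penaltyMultiplier σ γ (ψ t (x t)) := by
    rw [← penaltyMultiplier_at_level σ hμ0 hη hγ]
    exact penaltyMultiplier_mono hγ h1.le
  have e4 : μ ≤ penaltyMultiplier σ γ (ψ t (x t)) * ‖gradient (ψ t) (x t)‖ ^ 2 := by
    calc μ = μ / η ^ 2 * η ^ 2 := by field_simp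
      _ ≤ penaltyMultiplier σ γ (ψ t (x t)) * ‖gradient (ψ t) (x t)‖ ^ 2 :=
        mul_le_mul e3 (by gcongr) (by positivity) (penaltyMultiplier_nonneg _ hγ)
  linarith

omit [FiniteDimensional ℝ E] in
lemma penalized_lipschitz (h : IsConstraint T β η ψ) (hf : IsDynamics T M f U)
    {σ γ : ℝ} (hγ : 0 < γ) {u : ℝ → F} (hu : IsControl T U u) {x : ℝ → E}
    (hac : AbsolutelyContinuousOnInterval x 0 T)
    (hd : ∀ᵐ t ∂(volume.restrict (Icc (0 : ℝ) T)), HasDerivAt x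
      (f t (x t) (u t) - penaltyMultiplier σ γ (ψ t (x t)) • gradient (ψ t) (x t)) t)
    {m G : ℝ} (hm : ∀ t ∈ Icc 0 T, penaltyMultiplier σ γ (ψ t (x t)) ≤ m)
    (hG : ∀ t ∈ Icc 0 T, ‖gradient (ψ t) (x t)‖ ≤ G) :
    LipschitzOnWith (Real.toNNReal (M + m * G)) x (Icc 0 T) := by
  refine lipschitzOnWith_of_ae_hasDerivAt_norm_le hac h.pos.le ?_
  filter_upwards [hd, ae_restrict_mem measurableSet_Icc, hu.2] with t hdt htT hut
  refine ⟨_, le_trans ?_ (Real.le_coe_toNNReal _), hdt⟩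
  refine (norm_sub_le _ _).trans (add_le_add (hf.norm_le t htT _ _ hut) ?_)
  have h0 := penaltyMultiplier_nonneg (σ := σ) (ψ t (x t)) hγ
  rw [norm_smul, Real.norm_eq_abs, abs_of_nonneg h0]
  exact mul_le_mul (hm t htT) (hG t htT) (norm_nonneg _) (h0.trans (hm t htT))

/-- Invariance needs a Lipschitz curve. For a single solution, compactness of its graph gives bounds
depending on that solution, and these suffice here. -/
lemma penalized_mem_enlargedSet (h : IsConstraint T β η ψ) (hf : IsDynamics T M f U)
    (hμ : IsRateBound T μ f ψ U) {σ γ : ℝ} (hγ : 0 < γ) (hμ0 : 0 < μ)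
    (he : -β ≤ σ + penaltyLevel μ η γ) (he' : σ + penaltyLevel μ η γ < η) {u : ℝ → F}
    (hu : IsControl T U u) {x : ℝ → E} (hx : IsPenalizedSolution T f ψ σ γ u x)
    (h0 : x 0 ∈ enlargedSet ψ μ η σ γ 0) :
    ∀ t ∈ Icc 0 T, ψ t (x t) ≤ σ + penaltyLevel μ η γ := by
  obtain ⟨hac, hd⟩ := hx
  have hcont : ContinuousOn x (Icc 0 T) := by simpa [uIcc_of_le h.pos.le] using hac.continuousOn
  obtain ⟨G, hG⟩ := isCompact_Icc.exists_bound_of_continuousOn (h.continuousOn_gradient_comp hcont)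
  obtain ⟨m, hm⟩ := (isCompact_Icc (a := 0) (b := T)).exists_bound_of_continuousOn
    (f := fun t => penaltyMultiplier σ γ (ψ t (x t))) 
    ((continuous_penaltyMultiplier σ γ).comp_continuousOn (h.continuousOn_comp hcont))
  refine h.mem_enlargedSet_of_penalized hμ hγ hμ0 he he' hu
    ⟨_, h.penalized_lipschitz hf hγ hu hac hd (fun t ht => (le_abs_self _).trans (hm t ht)) hG⟩ ?_
    (hd.mono fun t ht _ => ht)
  have h0' : ψ 0 (x 0) - σ ≤ penaltyLevel μ η γ := h0
  linarith

end IsConstraint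

omit [InnerProductSpace ℝ E] [CompleteSpace E] [FiniteDimensional ℝ E] in
/-- Neighbourhood properties at a point of the limit hold along the approximations. -/
lemma exists_eventually_forall_of_tendstoUniformlyOn {x : ℕ → ℝ → E} {y : ℝ → E}
    (hxy : TendstoUniformlyOn x y atTop (Icc 0 T)) {t : ℝ}
    (ht : t ∈ Icc 0 T) (hy : ContinuousOn y (Icc 0 T)) {P : ℝ × E → Prop}
    (hP : ∀ᶠ p in 𝓝[Icc (0 : ℝ) T ×ˢ univ] (t, y t), P p) :
    ∃ δ > 0, ∀ᶠ k in atTop, ∀ s ∈ Icc 0 T, s ∈ Icc t (t + δ) → P (s, x k s) := by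
  rw [eventually_nhdsWithin_iff, Metric.eventually_nhds_iff] at hP
  obtain ⟨ε, hε, hP⟩ := hP
  obtain ⟨δ, hδ, hyδ⟩ := Metric.continuousOn_iff.1 hy t ht (ε / 2) (by positivity)
  refine ⟨min δ ε / 2, by positivity, ?_⟩
  filter_upwards [Metric.tendstoUniformlyOn_iff.1 hxy (ε / 2) (by positivity)] with k hk s hs hst
  have hmin : 0 < min δ ε := lt_min hδ hε
  have hd : dist s t < min δ ε := by
    rw [Real.dist_eq, abs_of_nonneg (by linarith [hst.1])]
    linarith [hst.2]
  refine hP ?_ ⟨hs, mem_univ _⟩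
  rw [Prod.dist_eq]
  refine max_lt (hd.trans_le (min_le_right _ _)) ?_
  have h1 := hk s hs
  have h2 := hyδ s hs (hd.trans_le (min_le_left _ _))
  calc dist (x k s) (y t) ≤ dist (x k s) (y s) + dist (y s) (y t) := dist_triangle _ _ _
    _ < ε / 2 + ε / 2 := by rw [dist_comm (x k s)]; exact add_lt_add h1 h2
    _ = ε := by ring

-- Compactness of `U` makes the continuity of `f` in `(t, x)` uniform in the control.
omit [InnerProductSpace ℝ E] [CompleteSpace E] [FiniteDimensional ℝ E] [MeasurableSpace F] in
lemma eventually_forall_norm_sub_lt {f : ℝ → E → F → E}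
    (hf : ContinuousOn (fun p : ℝ × E × F => f p.1 p.2.1 p.2.2) (Icc (0 : ℝ) T ×ˢ univ))
    (hU : IsCompact U) {t : ℝ} (ht : t ∈ Icc 0 T) (y : E) {ε : ℝ} (hε : 0 < ε) :
    ∀ᶠ p : ℝ × E in 𝓝[Icc (0 : ℝ) T ×ˢ univ] (t, y),
      ∀ u ∈ U, ‖f p.1 p.2 u - f t y u‖ < ε := by
  rw [eventually_nhdsWithin_iff]
  have h1 := hU.eventually_forall_of_forall_eventually (x₀ := (t, y))
    (P := fun (p : ℝ × E) u => p ∈ Icc (0 : ℝ) T ×ˢ (univ : Set E) → ‖f p.1 p.2 u - f t y u‖ < ε) (by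
      intro u _
      have h2 : ContinuousOn (fun q : (ℝ × E) × F => f q.1.1 q.1.2 q.2)
          ((Icc (0 : ℝ) T ×ˢ univ) ×ˢ univ) :=
        hf.comp (f := fun q : (ℝ × E) × F => (q.1.1, q.1.2, q.2)) (by fun_prop)
          fun q hq => ⟨hq.1.1, mem_univ _⟩
      have h2' : ContinuousOn (fun q : (ℝ × E) × F => f t y q.2)
          ((Icc (0 : ℝ) T ×ˢ univ) ×ˢ univ) :=
        hf.comp (f := fun q : (ℝ × E) × F => (t, y, q.2)) (by fun_prop)
          fun q hq => ⟨ht, mem_univ _⟩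
      have h3 := ((h2.sub h2').norm ((t, y), u) ⟨⟨ht, mem_univ _⟩, mem_univ _⟩).eventually_lt_const
        (u := ε) (by simpa using hε)
      rw [eventually_nhdsWithin_iff] at h3
      filter_upwards [h3] with q hq hq'
      exact hq ⟨hq', mem_univ _⟩)
  filter_upwards [h1] with p hp hp' u hu using hp u hu hp'

end Penalization

/-! ### Passage to the limit in the penalized equations -/

section Limit

variable {E F : Type*} [NormedAddCommGroup E] [InnerProductSpace ℝ E] [CompleteSpace E]
  [FiniteDimensional ℝ E] [TopologicalSpace F] [MeasurableSpace F]
  {T β η M μ : ℝ} {ψ : ℝ → E → ℝ} {f : ℝ → E → F → E} {U : Set F}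

namespace IsConstraint

/-- A limit of penalized solutions solves the sweeping inclusion, with bounded multipliers; the
velocity term is the one of the common control, if there is one. -/
lemma exists_subseq_limit (h : IsConstraint T β η ψ) (hf : IsDynamics T M f U)
    (hμ : IsRateBound T μ f ψ U) (hμ0 : 0 < μ) {σ γ : ℕ → ℝ} (hσ : Tendsto σ atTop (𝓝 0))
    (hγ0 : ∀ k, 0 < γ k) (hγ : Tendsto γ atTop atTop)
    (he : ∀ k, -β ≤ σ k + penaltyLevel μ η (γ k)) (he' : ∀ k, σ k + penaltyLevel μ η (γ k) < η)
    {u : ℕ → ℝ → F} (hu : ∀ k, IsControl T U (u k)) {x : ℕ → ℝ → E}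
    (hx : ∀ k, IsPenalizedSolution T f ψ (σ k) (γ k) (u k) (x k))
    (h0 : ∀ k, x k 0 ∈ enlargedSet ψ μ η (σ k) (γ k) 0) :
    ∃ (κ : ℕ → ℕ) (y : ℝ → E), StrictMono κ ∧
      TendstoUniformlyOn (fun j => x (κ j)) y atTop (Icc 0 T) ∧
      (∃ L, LipschitzOnWith L y (Icc 0 T)) ∧
      ∀ᵐ t ∂(volume.restrict (Icc (0 : ℝ) T)), ψ t (y t) ≤ 0 ∧
        ∃ a ∈ (fun w => f t (y t) w) '' U, ∃ l : ℝ, 0 ≤ l ∧ l * ψ t (y t) = 0 ∧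
          HasDerivAt y (a - l • gradient (ψ t) (y t)) t ∧
          ((∀ k, u k = u 0) → a = f t (y t) (u 0 t)) := by
  have hη := h.eta_pos
  have hT := h.pos.le
  have hψ : ∀ k, ∀ t ∈ Icc 0 T, ψ t (x k t) ≤ σ k + penaltyLevel μ η (γ k) := fun k =>
    h.penalized_mem_enlargedSet hf hμ (hγ0 k) hμ0 (he k) (he' k) (hu k) (hx k) (h0 k)
  set m : ℝ := μ / η ^ 2 with hm_def
  have hm0 : 0 ≤ m := by positivity
  have hm : ∀ k, ∀ t ∈ Icc 0 T, penaltyMultiplier (σ k) (γ k) (ψ t (x k t)) ≤ m := fun k t ht => by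
    rw [hm_def, ← penaltyMultiplier_at_level (σ k) hμ0 hη (hγ0 k)]
    exact penaltyMultiplier_mono (hγ0 k) (hψ k t ht)
  have hξ0 : ∀ k t, 0 ≤ penaltyMultiplier (σ k) (γ k) (ψ t (x k t)) := fun k t =>
    penaltyMultiplier_nonneg _ (hγ0 k)
  obtain ⟨u₀, hu₀⟩ : U.Nonempty := by
    have : NeZero (volume.restrict (Icc (0 : ℝ) T)) := ⟨by
      simpa [Measure.restrict_eq_zero] using h.pos⟩
    obtain ⟨t, ht⟩ := (hu 0).2.exists
    exact ⟨_, ht⟩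
  obtain ⟨R, hR⟩ := h.exists_bound hμ0 (fun t ht x hx => by
    have := hμ t ht u₀ hu₀ x (mem_movingSet_add hx)
    have h2 : 0 ≤ ‖gradient (ψ t) x‖ * ‖f t x u₀‖ := by positivity
    linarith)
  have hxR : ∀ k, ∀ t ∈ Icc 0 T, ‖x k t‖ ≤ R := fun k t ht =>
    hR t ht _ ((hψ k t ht).trans (he' k).le)
  obtain ⟨G, hG0, hG⟩ := h.exists_norm_gradient_le R
  have hxG : ∀ k, ∀ t ∈ Icc 0 T, ‖gradient (ψ t) (x k t)‖ ≤ G := fun k t ht =>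
    hG t ht _ (hxR k t ht)
  have hLx : ∀ k, LipschitzOnWith (Real.toNNReal (M + m * G)) (x k) (Icc 0 T) := fun k =>
    h.penalized_lipschitz hf (hγ0 k) (hu k) (hx k).1 (hx k).2 (hm k) (hxG k)
  have hξc : ∀ k, ContinuousOn (fun t => penaltyMultiplier (σ k) (γ k) (ψ t (x k t))) (Icc 0 T) :=
    fun k => (continuous_penaltyMultiplier _ _).comp_continuousOn
      (h.continuousOn_comp (hLx k).continuousOn)
  -- `I k` integrates the penalty vector and `Λ k` the scalar multiplier. Then `x k + I k` has
  -- derivative `f(t, x k, u k)`, so velocity and penalty pass to the limit separately.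
  have hIex : ∀ k, ∃ I : ℝ → E, I 0 = 0 ∧ LipschitzOnWith (Real.toNNReal (m * G)) I (Icc 0 T) ∧
      ∀ t ∈ Ioo 0 T, HasDerivAt I
        (penaltyMultiplier (σ k) (γ k) (ψ t (x k t)) • gradient (ψ t) (x k t)) t := fun k =>
    exists_lipschitz_primitive hT
      ((hξc k).smul (h.continuousOn_gradient_comp (hLx k).continuousOn)) fun t ht => by
        refine le_trans ?_ (Real.le_coe_toNNReal _)
        rw [Pi.smul_apply', norm_smul, Real.norm_eq_abs, abs_of_nonneg (hξ0 k t)]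
        exact mul_le_mul (hm k t ht) (hxG k t ht) (norm_nonneg _) hm0
  have hΛex : ∀ k, ∃ Λ : ℝ → ℝ, Λ 0 = 0 ∧ LipschitzOnWith (Real.toNNReal m) Λ (Icc 0 T) ∧
      ∀ t ∈ Ioo 0 T, HasDerivAt Λ (penaltyMultiplier (σ k) (γ k) (ψ t (x k t))) t := fun k =>
    exists_lipschitz_primitive hT (hξc k) fun t ht => by
        refine le_trans ?_ (Real.le_coe_toNNReal _)
        rw [Real.norm_eq_abs, abs_of_nonneg (hξ0 k t)]
        exact hm k t ht
  choose I hI0 hIL hId using hIex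
  choose Λ hΛ0 hΛL hΛd using hΛex
  have hAL := fun k => (hLx k).add (hIL k)
  have hAd : ∀ k, ∀ᵐ t ∂(volume.restrict (Icc (0 : ℝ) T)),
      HasDerivAt (fun t => x k t + I k t) (f t (x k t) (u k t)) t := fun k => by
    filter_upwards [(hx k).2, ae_restrict_Icc_mem_Ioo 0 T] with t ht htT
    have h1 : HasDerivAt (x k) (f t (x k t) (u k t) -
      penaltyMultiplier (σ k) (γ k) (ψ t (x k t)) • gradient (ψ t) (x k t)) t := ht
    have h2 := h1.add (hId k t htT)
    rw [sub_add_cancel] at h2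
    exact h2
  obtain ⟨κ, Y, hκ, hYL, hY⟩ := exists_subseq_tendstoUniformlyOn (W := E × E × ℝ)
    (X := fun k t => (x k t, x k t + I k t, Λ k t)) hT
    (fun k => (hLx k).prodMk ((hAL k).prodMk (hΛL k)))
    (R := max R (max (R + Real.toNNReal (m * G) * T) (Real.toNNReal m * T))) (fun k t ht => by
      have hz : (0 : ℝ) ∈ Icc 0 T := ⟨le_rfl, hT⟩
      have h1 : ‖I k t‖ ≤ Real.toNNReal (m * G) * T := by
        have := (hIL k).dist_le_mul t ht 0 hz
        rw [hI0, dist_zero_right, Real.dist_eq, sub_zero, abs_of_nonneg ht.1] at this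
        exact this.trans (by gcongr; exact ht.2)
      have h2 : ‖Λ k t‖ ≤ Real.toNNReal m * T := by
        have := (hΛL k).dist_le_mul t ht 0 hz
        rw [hΛ0, dist_zero_right, Real.dist_eq, sub_zero, abs_of_nonneg ht.1] at this
        exact this.trans (by gcongr; exact ht.2)
      rw [Prod.norm_def, Prod.norm_def]
      exact max_le_max (hxR k t ht) (max_le_max
        ((norm_add_le _ _).trans (add_le_add (hxR k t ht) h1)) h2))
  have hκt := hκ.tendsto_atTop
  have hy : TendstoUniformlyOn (fun j => x (κ j)) (fun t => (Y t).1) atTop (Icc 0 T) :=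
    uniformContinuous_fst.comp_tendstoUniformlyOn hY
  have hAt : ∀ s ∈ Icc 0 T, Tendsto (fun j => x (κ j) s + I (κ j) s) atTop (𝓝 (Y s).2.1) :=
    fun s hs => ((continuous_fst.comp continuous_snd).tendsto _).comp (hY.tendsto_at hs)
  have hΛt : ∀ s ∈ Icc 0 T, Tendsto (fun j => Λ (κ j) s) atTop (𝓝 (Y s).2.2) :=
    fun s hs => ((continuous_snd.comp continuous_snd).tendsto _).comp (hY.tendsto_at hs)
  have hyt : ∀ s ∈ Icc 0 T, Tendsto (fun j => x (κ j) s) atTop (𝓝 (Y s).1) :=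
    fun s hs => hy.tendsto_at hs
  have hyL := LipschitzWith.prod_fst.comp_lipschitzOnWith hYL
  have hyc : ContinuousOn (fun t => (Y t).1) (Icc 0 T) := hyL.continuousOn
  refine ⟨κ, fun t => (Y t).1, hκ, hy, ⟨_, hyL⟩, ?_⟩
  have hacA := fun k => absolutelyContinuous_of_lipschitzOnWith hT (hAL k)
  have hacI := fun k => absolutelyContinuous_of_lipschitzOnWith hT (hIL k)
  have hacΛ := fun k => absolutelyContinuous_of_lipschitzOnWith hT (hΛL k)
  have hIoo := ae_restrict_Icc_mem_Ioo 0 T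
  filter_upwards [hIoo, ae_differentiableAt_of_lipschitzOnWith hYL, ae_all_iff.2 hAd,
    (hu 0).2] with t ht hdY hAd_t hu0t
  have htT := Ioo_subset_Icc_self ht
  have hψy : ψ t (Y t).1 ≤ 0 := by
    have h1 : Tendsto (fun j => ψ t (x (κ j) t)) atTop (𝓝 (ψ t (Y t).1)) :=
      ((h.continuous_section htT).tendsto _).comp (hyt t htT)
    have h2 : Tendsto (fun j => σ (κ j) + penaltyLevel μ η (γ (κ j))) atTop (𝓝 0) := by
      have h3 := hσ.add (tendsto_penaltyLevel hμ0 hη hγ)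
      rw [add_zero] at h3
      exact h3.comp hκt
    exact le_of_tendsto_of_tendsto' h1 h2 fun j => hψ _ t htT
  obtain ⟨⟨d, a, l⟩, hd⟩ : ∃ D, HasDerivAt Y D t := ⟨_, hdY.hasDerivAt⟩
  have hdy : HasDerivAt (fun t => (Y t).1) d t := hd.fst
  have hdA : HasDerivAt (fun t => (Y t).2.1) a t := hd.snd.fst
  have hdΛ : HasDerivAt (fun t => (Y t).2.2) l t := hd.snd.snd
  set g₀ := gradient (ψ t) (Y t).1 with hg₀
  have ha : a ∈ (fun w => f t (Y t).1 w) '' U := by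
    have hcomp : IsCompact ((fun w => f t (Y t).1 w) '' U) :=
      hf.isCompact.image_of_continuousOn (hf.continuousOn.comp
        (f := fun w => (t, (Y t).1, w)) (by fun_prop) fun w _ => ⟨htT, mem_univ _⟩)
    -- Near `t` the velocities of the approximations lie within `ε` of the compact convex set `f(t,
    -- y(t), U)`; its closed thickening is convex, so it contains the limit derivative.
    have hmem : ∀ ε > 0, a ∈ Metric.cthickening ε ((fun w => f t (Y t).1 w) '' U) := by
      intro ε hε
      obtain ⟨δ, hδ, hev⟩ := exists_eventually_forall_of_tendstoUniformlyOn hy htT hyc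
        (eventually_forall_norm_sub_lt hf.continuousOn hf.isCompact htT (Y t).1 hε)
      refine hasDerivAt_mem_of_tendsto ht hδ ((hf.convex t htT _).cthickening ε)
        Metric.isClosed_cthickening (Eventually.of_forall fun j => hacA (κ j)) ?_ hAt hdA
      filter_upwards [hev] with j hj
      filter_upwards [hAd (κ j), (hu (κ j)).2, ae_restrict_mem measurableSet_Icc]
        with s hs hus hsT hst
      refine ⟨_, Metric.mem_cthickening_of_dist_le _ (f t (Y t).1 (u (κ j) s)) ε _
        ⟨_, hus, rfl⟩ ?_, hs⟩
      rw [dist_eq_norm]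
      exact (hj s hsT hst _ hus).le
    rw [← hcomp.isClosed.closure_eq, Metric.closure_eq_iInter_cthickening]
    exact mem_iInter₂.2 hmem
  have hl0 : 0 ≤ l := by
    refine hasDerivAt_mem_of_tendsto (Q := Ici 0) ht one_pos (convex_Ici 0) isClosed_Ici
      (Eventually.of_forall fun j => hacΛ (κ j)) (Eventually.of_forall fun j => ?_) hΛt hdΛ
    filter_upwards [hIoo] with s hs _
    exact ⟨_, hξ0 _ _, hΛd _ s hs⟩
  have hlψ : l * ψ t (Y t).1 = 0 := by
    rcases hψy.eq_or_lt with h1 | h1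
    · rw [h1, mul_zero]
    -- If `ψ(t,y(t)) < c < 0`, nearby values of `ψ` along the approximations are below `c`, where
    -- the multipliers tend to zero.
    have hl : ∀ ε > 0, l ≤ ε := by
      intro ε hε
      obtain ⟨c, hc1, hc2⟩ := exists_between h1
      obtain ⟨δ, hδ, hev⟩ := exists_eventually_forall_of_tendstoUniformlyOn hy htT hyc
        ((h.continuousOn (t, (Y t).1) ⟨htT, mem_univ _⟩).eventually_lt_const hc1)
      refine hasDerivAt_mem_of_tendsto (Q := Iic ε) ht hδ (convex_Iic ε) isClosed_Iic
        (Eventually.of_forall fun j => hacΛ (κ j)) ?_ hΛt hdΛ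
      filter_upwards [hev, ((tendsto_penaltyMultiplier hσ hγ hc2).comp hκt).eventually_lt_const hε]
        with j hj hj'
      filter_upwards [hIoo] with s hs hst
      refine ⟨_, ?_, hΛd _ s hs⟩
      exact (penaltyMultiplier_mono (hγ0 _) (hj s (Ioo_subset_Icc_self hs) hst).le).trans hj'.le
    rw [le_antisymm (le_of_forall_pos_le_add fun ε hε => by simpa using hl ε hε) hl0, zero_mul]
  have hdeq : d = a - l • g₀ := by
    -- The derivative of `I k - Λ k • g₀` is the bounded multiplier times `∇ψ(s, x k(s)) - g₀`,
    -- which is small near `t`; the limit curve has derivative `a - d - l • g₀`.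
    have hsmall : ∀ ε > 0, ‖a - d - l • g₀‖ ≤ ε := by
      intro ε hε
      have hcg := ((h.continuousOn_gradient (t, (Y t).1) ⟨htT, mem_univ _⟩).sub
        (continuousWithinAt_const (b := g₀))).norm
      obtain ⟨δ, hδ, hev⟩ := exists_eventually_forall_of_tendstoUniformlyOn hy htT hyc
        (hcg.eventually_lt_const (u := ε / (m + 1)) (by simpa [hg₀] using by positivity))
      rw [← mem_closedBall_zero_iff]
      refine hasDerivAt_mem_of_tendsto (B := fun j s => I (κ j) s - Λ (κ j) s • g₀)
        (B₀ := fun s => (Y s).2.1 - (Y s).1 - (Y s).2.2 • g₀) ht hδ (convex_closedBall _ _)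
        Metric.isClosed_closedBall (Eventually.of_forall fun j => ?_) ?_ (fun s hs => ?_)
        ((hdA.sub hdy).sub (hdΛ.smul_const g₀))
      · have : LipschitzWith ‖g₀‖₊ (fun r : ℝ => r • g₀) := LipschitzWith.of_dist_le_mul
          fun r s => by
            rw [dist_eq_norm, ← sub_smul, norm_smul, mul_comm, dist_eq_norm, coe_nnnorm]
        exact (hacI _).sub (lipschitzWith_comp_absolutelyContinuous this (hacΛ _))
      · filter_upwards [hev] with j hj
        filter_upwards [hIoo] with s hs hst
        refine ⟨_, ?_, (hId (κ j) s hs).sub ((hΛd (κ j) s hs).smul_const g₀)⟩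
        rw [← smul_sub, mem_closedBall_zero_iff, norm_smul, Real.norm_eq_abs,
          abs_of_nonneg (hξ0 _ _)]
        have hsT := Ioo_subset_Icc_self hs
        calc _ ≤ (m + 1) * (ε / (m + 1)) :=
              mul_le_mul ((hm _ s hsT).trans (by linarith)) (hj s hsT hst).le (norm_nonneg _)
                (by positivity)
          _ = ε := by field_simp
      · have h1 := ((hAt s hs).sub (hyt s hs)).sub ((hΛt s hs).smul_const g₀)
        simpa using h1
    have h0 : a - d - l • g₀ = 0 := by
      rw [← norm_le_zero_iff]
      exact le_of_forall_pos_le_add fun ε hε => by simpa using hsmall ε hε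
    have : a - d - l • g₀ = (a - l • g₀) - d := by abel
    rw [this] at h0
    exact (sub_eq_zero.1 h0).symm
  refine ⟨hψy, a, ha, l, hl0, hlψ, hdeq ▸ hdy, fun hconst => ?_⟩
  -- A merely measurable control cannot be frozen near `t`. Instead the curves are compared with a
  -- fixed one, of index `κ J`: with the same control, the velocities differ by at most `2Mε`
  -- through the Lipschitz bound in `x`, and the derivative of the fixed curve at `t` is known.
  have hsmall : ∀ ε > 0, ‖a - f t (Y t).1 (u 0 t)‖ ≤ 3 * M * ε := by
    intro ε hε
    obtain ⟨J, hJ⟩ := eventually_atTop.1 (Metric.tendstoUniformlyOn_iff.1 hy ε hε)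
    have h1 : ‖a - f t (x (κ J) t) (u (κ J) t)‖ ≤ M * (2 * ε) := by
      rw [← mem_closedBall_zero_iff]
      refine hasDerivAt_mem_of_tendsto
        (B := fun j s => (x (κ j) s + I (κ j) s) - (x (κ J) s + I (κ J) s))
        (B₀ := fun s => (Y s).2.1 - (x (κ J) s + I (κ J) s)) ht one_pos (convex_closedBall _ _)
        Metric.isClosed_closedBall (Eventually.of_forall fun j => (hacA _).sub (hacA _)) ?_
        (fun s hs => (hAt s hs).sub_const _) (hdA.sub (hAd_t _))
      filter_upwards [eventually_ge_atTop J] with j hj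
      filter_upwards [hAd (κ j), hAd (κ J), (hu 0).2, ae_restrict_mem measurableSet_Icc]
        with s hs hs' hus hsT _
      refine ⟨_, ?_, hs.sub hs'⟩
      rw [mem_closedBall_zero_iff, hconst (κ j), hconst (κ J)]
      refine (hf.lipschitz s hsT _ hus _ _).trans ?_
      have hM := hf.pos
      gcongr
      rw [← dist_eq_norm]
      have e1 := hJ j hj s hsT
      have e2 := hJ J le_rfl s hsT
      rw [dist_comm] at e1
      linarith [dist_triangle (x (κ j) s) (Y s).1 (x (κ J) s)]
    have h2 : ‖f t (x (κ J) t) (u 0 t) - f t (Y t).1 (u 0 t)‖ ≤ M * ε := by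
      refine (hf.lipschitz t htT _ hu0t _ _).trans ?_
      have hM := hf.pos
      gcongr
      rw [← dist_eq_norm, dist_comm]
      exact (hJ J le_rfl t htT).le
    rw [hconst (κ J)] at h1
    calc _ ≤ ‖a - f t (x (κ J) t) (u 0 t)‖ + ‖f t (x (κ J) t) (u 0 t) - f t (Y t).1 (u 0 t)‖ :=
          norm_sub_le_norm_sub_add_norm_sub _ _ _
      _ ≤ 3 * M * ε := by linarith
  rw [← sub_eq_zero, ← norm_le_zero_iff]
  refine le_of_forall_pos_le_add fun ε hε => ?_
  have hM := hf.pos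
  have := hsmall (ε / (3 * M)) (by positivity)
  rw [zero_add]
  exact this.trans_eq (by field_simp)

end IsConstraint

end Limit

/-! ### Measurable selection and Filippov's lemma -/

section Selection

/-- By compactness the infimum over `X` is attained, and by continuity it can be computed on a
countable dense set. -/
lemma measurableSet_exists_le_zero {α X : Type*} [MeasurableSpace α] [TopologicalSpace X]
    [CompactSpace X] [TopologicalSpace.SeparableSpace X] {G : α → X → ℝ}
    (hm : ∀ x, Measurable fun t => G t x) (hc : ∀ t, Continuous (G t)) :
    MeasurableSet {t | ∃ x, G t x ≤ 0} := by
  rcases isEmpty_or_nonempty X with hX | hX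
  · simp
  have : {t | ∃ x, G t x ≤ 0} = ⋂ n : ℕ, ⋃ i : ℕ,
      {t | G t (TopologicalSpace.denseSeq X i) < 1 / ((n : ℝ) + 1)} := by
    ext t
    simp only [mem_ofPred_eq, mem_iInter, mem_iUnion]
    constructor
    · rintro ⟨x, hx⟩ n
      have hopen : IsOpen {z | G t z < 1 / ((n : ℝ) + 1)} := isOpen_lt (hc t) continuous_const
      obtain ⟨i, hi⟩ := (TopologicalSpace.denseRange_denseSeq X).exists_mem_open hopen
        ⟨x, hx.trans_lt (by positivity)⟩
      exact ⟨i, hi⟩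
    · intro hn
      obtain ⟨x, -, hx⟩ := isCompact_univ.exists_isMinOn univ_nonempty (hc t).continuousOn
      refine ⟨x, le_of_forall_pos_lt_add fun ε hε => ?_⟩
      obtain ⟨n, hn'⟩ := exists_nat_one_div_lt hε
      obtain ⟨i, hi⟩ := hn n
      have h1 : G t x ≤ G t (TopologicalSpace.denseSeq X i) := hx (mem_univ _)
      linarith
  rw [this]
  exact MeasurableSet.iInter fun n => MeasurableSet.iUnion fun i =>
    measurableSet_lt (hm _) measurable_const

/-- Measurable selection of zeros of a nonnegative Carathéodory function on a compact set. -/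
lemma exists_measurable_selection {α F : Type*} [MeasurableSpace α] [MetricSpace F]
    [MeasurableSpace F] [BorelSpace F] {U : Set F} (hU : IsCompact U) (hne : U.Nonempty)
    {G : α → F → ℝ} (hm : ∀ u, Measurable fun t => G t u) (hc : ∀ t, Continuous (G t)) :
    ∃ v : α → F, Measurable v ∧ (∀ t, v t ∈ U) ∧
      ∀ t, (∃ u ∈ U, G t u ≤ 0) → G t (v t) ≤ 0 := by
  classical
  have : CompactSpace U := isCompact_iff_compactSpace.1 hU
  have : Nonempty U := hne.to_subtype
  -- Parametrizing `U` by the Cantor set, a compact subset of `ℝ`, allows the least admissible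
  -- parameter to be selected.
  obtain ⟨π, hπ, hπs⟩ := exists_nat_bool_continuous_surjective_of_compact U
  set p : cantorSet → F := fun c => π (cantorSetHomeomorphNatToBool c) with hp
  have hpc : Continuous p := by fun_prop
  have hps : ∀ u ∈ U, ∃ c, p c = u := fun u hu => by
    obtain ⟨c, hc⟩ := hπs ⟨u, hu⟩
    exact ⟨cantorSetHomeomorphNatToBool.symm c, by simp [hp, hc]⟩
  have hpU : ∀ c, p c ∈ U := fun c => (π (cantorSetHomeomorphNatToBool c)).2
  have : CompactSpace cantorSet := isCompact_iff_compactSpace.1 isCompact_cantorSet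
  set B : Set α := {t | ∃ c, G t (p c) ≤ 0} with hB
  have hBm : MeasurableSet B :=
    measurableSet_exists_le_zero (fun c => hm (p c)) fun t => (hc t).comp hpc
  -- Off `B` every parameter is declared admissible, so that `S t` is never empty.
  set H : α → cantorSet → ℝ := fun t c => if t ∈ B then G t (p c) else 0 with hH
  have hHm : ∀ c, Measurable fun t => H t c := fun c => (hm (p c)).ite hBm measurable_const
  have hHc : ∀ t, Continuous (H t) := fun t => by
    by_cases ht : t ∈ B
    · simpa [hH, ht, Function.comp_def] using (hc t).comp hpc
    · simpa [hH, ht] using continuous_const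
  set S : α → Set ℝ := fun t => Subtype.val '' {c : cantorSet | H t c ≤ 0} with hS
  have hScomp : ∀ t, IsCompact (S t) := fun t =>
    ((isClosed_le (hHc t) continuous_const).isCompact).image continuous_subtype_val
  have hSne : ∀ t, (S t).Nonempty := fun t => by
    by_cases ht : t ∈ B
    · obtain ⟨c, hc⟩ := ht
      exact ⟨c, c, by simpa [hH, show t ∈ B from ⟨c, hc⟩] using hc, rfl⟩
    · obtain ⟨c⟩ : Nonempty cantorSet := ⟨cantorSetHomeomorphNatToBool.symm fun _ => true⟩
      exact ⟨c, c, by simp [hH, ht], rfl⟩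
  have hmin : ∀ t, sInf (S t) ∈ S t := fun t => (hScomp t).sInf_mem (hSne t)
  -- The least parameter is at most `r` exactly when an admissible one exists in the compact set of
  -- parameters up to `r`.
  have hmeas : Measurable fun t => sInf (S t) := by
    refine measurable_of_Iic fun r => ?_
    have hcl : IsClosed {c : cantorSet | (c : ℝ) ≤ r} :=
      isClosed_le continuous_subtype_val continuous_const
    have : CompactSpace {c : cantorSet | (c : ℝ) ≤ r} := isCompact_iff_compactSpace.1 hcl.isCompact
    convert measurableSet_exists_le_zero (X := {c : cantorSet | (c : ℝ) ≤ r})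
      (G := fun t c => H t c) (fun c => hHm c) (fun t => (hHc t).comp continuous_subtype_val) using 1
    ext t
    simp only [mem_preimage, mem_Iic, mem_ofPred_eq]
    constructor
    · intro ht
      obtain ⟨c, hc, hceq⟩ := hmin t
      exact ⟨⟨c, by rw [mem_ofPred_eq, hceq]; exact ht⟩, hc⟩
    · rintro ⟨c, hc⟩
      exact (csInf_le (hScomp t).bddBelow ⟨c, hc, rfl⟩).trans c.2
  have hmemK : ∀ t, sInf (S t) ∈ cantorSet := fun t => by
    obtain ⟨c, -, hc⟩ := hmin t
    rw [← hc]
    exact c.2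
  refine ⟨fun t => p ⟨sInf (S t), hmemK t⟩, hpc.measurable.comp (hmeas.subtype_mk), fun t => hpU _,
    fun t ht => ?_⟩
  obtain ⟨u, hu, hGu⟩ := ht
  obtain ⟨c₀, rfl⟩ := hps u hu
  have htB : t ∈ B := ⟨c₀, hGu⟩
  obtain ⟨c, hc, hceq⟩ := hmin t
  have : (⟨sInf (S t), hmemK t⟩ : cantorSet) = c := Subtype.ext hceq.symm
  have hc' : G t (p c) ≤ 0 := by simpa [hH, htB] using hc
  rwa [← this] at hc'

variable {E F : Type*} [NormedAddCommGroup E] [InnerProductSpace ℝ E] [CompleteSpace E]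
  [FiniteDimensional ℝ E] [MetricSpace F] [MeasurableSpace F] [BorelSpace F]
  {T β η M μ : ℝ} {ψ : ℝ → E → ℝ} {f : ℝ → E → F → E} {U : Set F}

omit [InnerProductSpace ℝ E] [CompleteSpace E] [FiniteDimensional ℝ E] [MeasurableSpace F]
  [BorelSpace F] in
lemma continuous_projIcc_comp
    (hf : ContinuousOn (fun p : ℝ × E × F => f p.1 p.2.1 p.2.2) (Icc (0 : ℝ) T ×ˢ univ))
    (hT : 0 ≤ T) : Continuous fun p : ℝ × E × F => f (projIcc 0 T hT p.1) p.2.1 p.2.2 :=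
  hf.comp_continuous (f := fun p : ℝ × E × F => ((projIcc 0 T hT p.1 : ℝ), p.2))
    (by fun_prop) fun p => ⟨(projIcc 0 T hT p.1).2, mem_univ _⟩

/-- Filippov's lemma: a solution of the inclusion is generated by a measurable control. -/
lemma IsConstraint.exists_control (h : IsConstraint T β η ψ) (hf : IsDynamics T M f U)
    {y : ℝ → E} (hy : ContinuousOn y (Icc 0 T))
    (hd : ∀ᵐ t ∂(volume.restrict (Icc (0 : ℝ) T)), ψ t (y t) ≤ 0 ∧
        ∃ a ∈ (fun w => f t (y t) w) '' U, ∃ l : ℝ, 0 ≤ l ∧ l * ψ t (y t) = 0 ∧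
          HasDerivAt y (a - l • gradient (ψ t) (y t)) t) :
    ∃ u : ℝ → F, Measurable u ∧ (∀ t, u t ∈ U) ∧
      ∀ᵐ t ∂(volume.restrict (Icc (0 : ℝ) T)), ψ t (y t) ≤ 0 ∧ ∃ l : ℝ, 0 ≤ l ∧
        l * ψ t (y t) = 0 ∧ HasDerivAt y (f t (y t) (u t) - l • gradient (ψ t) (y t)) t := by
  have hT := h.pos.le
  have hne : U.Nonempty := by
    have : NeZero (volume.restrict (Icc (0 : ℝ) T)) := ⟨by
      simpa [Measure.restrict_eq_zero] using h.pos⟩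
    obtain ⟨t, -, a, ⟨w, hw, -⟩, -⟩ := hd.exists
    exact ⟨w, hw⟩
  have hproj : ∀ t, (projIcc 0 T hT t : ℝ) ∈ Icc 0 T := fun t => (projIcc 0 T hT t).2
  have hcp : Continuous fun t => (projIcc 0 T hT t : ℝ) := by fun_prop
  have hyc : Continuous fun t => y (projIcc 0 T hT t) := hy.comp_continuous hcp hproj
  have hψc : Continuous fun t => ψ (projIcc 0 T hT t) (y (projIcc 0 T hT t)) :=
    (h.continuousOn_comp hy).comp_continuous hcp hproj
  have hgc : Continuous fun t => gradient (ψ (projIcc 0 T hT t)) (y (projIcc 0 T hT t)) :=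
    (h.continuousOn_gradient_comp hy).comp_continuous hcp hproj
  have hfc := continuous_projIcc_comp hf.continuousOn hT
  borelize E
  set w : ℝ → F → E := fun t u => f (projIcc 0 T hT t) (y (projIcc 0 T hT t)) u - deriv y t
  have hwm : ∀ u, Measurable fun t => w t u := fun u =>
    (hfc.comp (g := fun p : ℝ × E × F => f (projIcc 0 T hT p.1) p.2.1 p.2.2)
      (f := fun t => (t, y (projIcc 0 T hT t), u))
      (continuous_id.prodMk (hyc.prodMk continuous_const))).measurable.sub (measurable_deriv y)
  have hwc : ∀ t, Continuous (w t) := fun t =>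
    (hfc.comp (g := fun p : ℝ × E × F => f (projIcc 0 T hT p.1) p.2.1 p.2.2)
      (f := fun u => (t, y (projIcc 0 T hT t), u)) (by fun_prop)).sub continuous_const
  -- The two terms vanish together exactly when `ψ w = 0` and `‖g‖ w = ‖w‖ g`, `g` the gradient.
  -- This encodes `w = l g` with `l ≥ 0` and `l ψ = 0` without a multiplier to be selected.
  obtain ⟨u, hum, huU, hu⟩ := exists_measurable_selection hf.isCompact hne
    (G := fun t u => |ψ (projIcc 0 T hT t) (y (projIcc 0 T hT t))| * ‖w t u‖ +
      ‖‖gradient (ψ (projIcc 0 T hT t)) (y (projIcc 0 T hT t))‖ • w t u -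
        ‖w t u‖ • gradient (ψ (projIcc 0 T hT t)) (y (projIcc 0 T hT t))‖)
    (fun u => (hψc.abs.measurable.mul (hwm u).norm).add
      ((hgc.norm.measurable.smul (hwm u)).sub ((hwm u).norm.smul hgc.measurable)).norm)
    (fun t => by have := hwc t; fun_prop)
  refine ⟨u, hum, huU, ?_⟩
  filter_upwards [hd, ae_restrict_mem measurableSet_Icc] with t ht htT
  obtain ⟨hψt, a, ⟨z, hz, rfl⟩, l, hl0, hlψ, hdt⟩ := ht
  refine ⟨hψt, ?_⟩
  have hut := hu t
  have hpt : (projIcc 0 T hT t : ℝ) = t := by rw [projIcc_of_mem hT htT]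
  simp only [w, hpt, hdt.deriv] at hut
  have h1 := hut ⟨z, hz, by
    simp only [sub_sub_cancel, norm_smul, Real.norm_eq_abs, abs_of_nonneg hl0]
    rw [smul_smul, mul_comm l, sub_self, norm_zero, add_zero]
    have : |ψ t (y t)| * l = 0 := by
      rw [← abs_of_nonneg hl0, ← abs_mul, mul_comm, hlψ, abs_zero]
    rw [mul_comm ‖_‖ l, ← mul_assoc, this, zero_mul]⟩
  set v := f t (y t) (u t) - (f t (y t) z - l • gradient (ψ t) (y t)) with hv
  set g := gradient (ψ t) (y t) with hg
  have h2 : |ψ t (y t)| * ‖v‖ = 0 := by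
    refine le_antisymm ?_ (by positivity)
    linarith [norm_nonneg (‖g‖ • v - ‖v‖ • g)]
  have h3 : ‖g‖ • v - ‖v‖ • g = 0 := by
    rw [← norm_le_zero_iff]
    linarith
  -- Where `ψ ≠ 0` the gradient may vanish, but there `v = 0` and the quotient is `0`, also when it
  -- is `0/0`.
  have hvg : v = (‖v‖ / ‖g‖) • g := by
    rcases mul_eq_zero.1 h2 with h4 | h4
    · have hg0 : ‖g‖ ≠ 0 := norm_ne_zero_iff.2
        (h.gradient_ne_zero htT (by rw [abs_eq_zero.1 h4]; linarith [h.beta_pos]))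
      rw [div_eq_inv_mul, mul_smul, ← sub_eq_zero.1 h3, smul_smul, inv_mul_cancel₀ hg0, one_smul]
    · rw [h4]
      simpa using norm_eq_zero.1 h4
  refine ⟨‖v‖ / ‖g‖, by positivity, ?_, ?_⟩
  · have : ‖v‖ * ψ t (y t) = 0 := by
      rcases mul_eq_zero.1 h2 with h4 | h4
      · rw [abs_eq_zero.1 h4, mul_zero]
      · rw [h4, zero_mul]
    rw [div_mul_eq_mul_div, this, zero_div]
  · rw [← hvg, hv, sub_sub_cancel]
    exact hdt

end Selection

/-! ### Carathéodory existence and solvability of the penalized equation -/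

section Existence

/-- Global existence for Carathéodory differential equations with bounded Lipschitz right-hand
side. -/
lemma exists_caratheodory_solution {W : Type*} [NormedAddCommGroup W] [NormedSpace ℝ W]
    [CompleteSpace W] {φ : ℝ → W → W} {T : ℝ} {K B : NNReal} (hT : 0 ≤ T)
    (hm : ∀ x : ℝ → W, Continuous x → AEStronglyMeasurable (fun t => φ t (x t)) volume)
    (hK : ∀ t x y, ‖φ t x - φ t y‖ ≤ K * ‖x - y‖) (hB : ∀ t x, ‖φ t x‖ ≤ B) (b : W) :
    ∃ x : ℝ → W, x 0 = b ∧ LipschitzOnWith B x (Icc 0 T) ∧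
      ∀ᵐ t ∂(volume.restrict (Icc (0 : ℝ) T)), HasDerivAt x (φ t (x t)) t := by
  have hint : ∀ x : ℝ → W, Continuous x → LocallyIntegrable (fun t => φ t (x t)) volume :=
    fun x hx => (locallyIntegrable_const (B : ℝ)).mono (hm x hx)
      (Eventually.of_forall fun t => by simpa using hB t (x t))
  have hii : ∀ x : ℝ → W, Continuous x → ∀ s t, IntervalIntegrable (fun t => φ t (x t)) volume s t :=
    fun x hx s t => intervalIntegrable_iff.mpr <|
      ((hint x hx).integrableOn_isCompact isCompact_uIcc).mono_set uIoc_subset_uIcc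
  set e : C(Icc (0 : ℝ) T, W) → ℝ → W := fun α t => α (projIcc 0 T hT t) with he
  have hec : ∀ α, Continuous (e α) := fun α => by fun_prop
  have hprim : ∀ x : ℝ → W, Continuous x → LipschitzWith B fun t => b + ∫ s in (0 : ℝ)..t, φ s (x s) := by
    intro x hx
    refine LipschitzWith.of_dist_le_mul fun s t => ?_
    rw [dist_add_left, dist_eq_norm, intervalIntegral.integral_interval_sub_left (hii x hx _ _)
      (hii x hx _ _), Real.dist_eq]
    exact intervalIntegral.norm_integral_le_of_norm_le_const fun r _ => hB r (x r)
  set Φ : C(Icc (0 : ℝ) T, W) → C(Icc (0 : ℝ) T, W) := fun α =>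
    ⟨fun t => b + ∫ s in (0 : ℝ)..t, φ s (e α s),
      (hprim _ (hec α)).continuous.comp continuous_subtype_val⟩ with hΦ
  -- The factorial makes some iterate of the Picard map a contraction on all of `[0,T]`, so the
  -- interval need not be subdivided.
  have hiter : ∀ n (α β : C(Icc (0 : ℝ) T, W)) (t : Icc (0 : ℝ) T),
      ‖(Φ^[n] α) t - (Φ^[n] β) t‖ ≤ (K * (t : ℝ)) ^ n / n.factorial * dist α β := by
    intro n α β
    induction n with
    | zero =>
      intro t
      simpa [dist_eq_norm] using ContinuousMap.dist_apply_le_dist (f := α) (g := β) t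
    | succ n ih =>
      intro t
      rw [Function.iterate_succ_apply', Function.iterate_succ_apply']
      simp only [hΦ, ContinuousMap.coe_mk]
      rw [add_sub_add_left_eq_sub, ← intervalIntegral.integral_sub (hii _ (hec _) _ _)
        (hii _ (hec _) _ _)]
      have hbd : ∀ s ∈ Ioc (0 : ℝ) t, ‖φ s (e (Φ^[n] α) s) - φ s (e (Φ^[n] β) s)‖ ≤
          K ^ (n + 1) / n.factorial * dist α β * s ^ n := by
        intro s hs
        have hsT : s ∈ Icc 0 T := ⟨hs.1.le, hs.2.trans t.2.2⟩
        have h1 := ih ⟨s, hsT⟩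
        refine (hK _ _ _).trans ?_
        simp only [he, projIcc_of_mem hT hsT]
        calc _ ≤ K * ((K * s) ^ n / n.factorial * dist α β) := by gcongr
          _ = _ := by rw [mul_pow]; ring
      refine (intervalIntegral.norm_integral_le_of_norm_le t.2.1
        (Eventually.of_forall hbd) (Continuous.intervalIntegrable (by fun_prop) _ _)).trans ?_
      rw [intervalIntegral.integral_const_mul, integral_pow, Nat.factorial_succ]
      push_cast
      rw [mul_pow, zero_pow (Nat.succ_ne_zero n), sub_zero]
      apply le_of_eq
      field_simp
  obtain ⟨n, hn⟩ := ((FloorSemiring.tendsto_pow_div_factorial_atTop (K * T : ℝ)).eventually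
    (gt_mem_nhds zero_lt_one)).exists
  have hKT : 0 ≤ (K * T : ℝ) ^ n / n.factorial := by
    have := K.2
    positivity
  have hcontr : ContractingWith (Real.toNNReal ((K * T) ^ n / n.factorial)) Φ^[n] := by
    refine ⟨Real.toNNReal_lt_one.2 hn, LipschitzWith.of_dist_le_mul fun α β => ?_⟩
    rw [ContinuousMap.dist_le (by positivity)]
    intro t
    rw [dist_eq_norm]
    refine (hiter n α β t).trans ?_
    have h1 := t.2.1
    have h2 := t.2.2
    rw [Real.coe_toNNReal _ hKT]
    gcongr
  obtain ⟨α, hα⟩ : ∃ α, Φ α = α := ⟨_, hcontr.isFixedPt_fixedPoint_iterate⟩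
  have hαt : ∀ t ∈ Icc 0 T, b + ∫ s in (0 : ℝ)..t, φ s (e α s) = e α t := fun t ht => by
    have := congrArg (fun g : C(Icc (0 : ℝ) T, W) => g ⟨t, ht⟩) hα
    simpa [hΦ, he, projIcc_of_mem hT ht] using this
  refine ⟨fun t => b + ∫ s in (0 : ℝ)..t, φ s (e α s), by simp,
    (hprim _ (hec α)).lipschitzOnWith, ?_⟩
  filter_upwards [ae_restrict_of_ae (LocallyIntegrable.ae_hasDerivAt_integral (hint _ (hec α))),
    ae_restrict_mem measurableSet_Icc] with t ht htT
  rw [hαt t htT]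
  exact (ht 0).const_add b

/-- The radial retraction onto the closed ball of radius `R`. -/
noncomputable def radialRetraction {W : Type*} [NormedAddCommGroup W] [NormedSpace ℝ W] (R : ℝ)
    (x : W) : W := (R / max R ‖x‖) • x

lemma radialRetraction_of_norm_le {W : Type*} [NormedAddCommGroup W] [NormedSpace ℝ W] {R : ℝ}
    (hR : 0 < R) {x : W} (hx : ‖x‖ ≤ R) : radialRetraction R x = x := by
  rw [radialRetraction, max_eq_left hx, div_self hR.ne', one_smul]

lemma norm_radialRetraction_le {W : Type*} [NormedAddCommGroup W] [NormedSpace ℝ W] {R : ℝ}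
    (hR : 0 < R) (x : W) : ‖radialRetraction R x‖ ≤ R := by
  have hm : 0 < max R ‖x‖ := lt_max_of_lt_left hR
  rw [radialRetraction, norm_smul, Real.norm_eq_abs, abs_of_pos (by positivity),
    div_mul_eq_mul_div, div_le_iff₀ hm]
  gcongr
  exact le_max_right _ _

/-- Valid in any normed space: the displacement and the change of the scaling factor each contribute
`‖x - y‖`. -/
lemma norm_radialRetraction_sub_le {W : Type*} [NormedAddCommGroup W] [NormedSpace ℝ W] {R : ℝ}
    (hR : 0 < R) (x y : W) :
    ‖radialRetraction R x - radialRetraction R y‖ ≤ 2 * ‖x - y‖ := by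
  have hx : 0 < max R ‖x‖ := lt_max_of_lt_left hR
  have hy : 0 < max R ‖y‖ := lt_max_of_lt_left hR
  have e1 : radialRetraction R x - radialRetraction R y =
      (R / max R ‖x‖) • (x - y) + (R / max R ‖x‖ - R / max R ‖y‖) • y := by
    simp only [radialRetraction]
    module
  have e2 : |R / max R ‖x‖ - R / max R ‖y‖| * ‖y‖ ≤ ‖x - y‖ := by
    have e3 : R / max R ‖x‖ - R / max R ‖y‖ =
        (R / max R ‖x‖) * ((max R ‖y‖ - max R ‖x‖) / max R ‖y‖) := by
      field_simp
    have e4 : |max R ‖y‖ - max R ‖x‖| ≤ ‖x - y‖ := by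
      have h1 := abs_max_sub_max_le_abs ‖y‖ ‖x‖ R
      rw [max_comm, max_comm ‖x‖] at h1
      rw [norm_sub_rev]
      exact h1.trans (abs_norm_sub_norm_le y x)
    have e5 : R / max R ‖x‖ ≤ 1 := (div_le_one hx).2 (le_max_left _ _)
    rw [e3, abs_mul, abs_of_pos (show 0 < R / max R ‖x‖ by positivity), abs_div, abs_of_pos hy]
    calc R / max R ‖x‖ * (|max R ‖y‖ - max R ‖x‖| / max R ‖y‖) * ‖y‖
        ≤ 1 * (‖x - y‖ / max R ‖y‖) * max R ‖y‖ := by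
          gcongr
          exact le_max_right _ _
      _ = ‖x - y‖ := by field_simp
  rw [e1]
  refine (norm_add_le _ _).trans ?_
  rw [norm_smul, norm_smul, Real.norm_eq_abs, Real.norm_eq_abs,
    abs_of_pos (show 0 < R / max R ‖x‖ by positivity)]
  have e5 : R / max R ‖x‖ ≤ 1 := (div_le_one hx).2 (le_max_left _ _)
  have := mul_le_mul_of_nonneg_right e5 (norm_nonneg (x - y))
  linarith

lemma continuous_radialRetraction {W : Type*} [NormedAddCommGroup W] [NormedSpace ℝ W] {R : ℝ}
    (hR : 0 < R) : Continuous (radialRetraction (W := W) R) :=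
  (LipschitzWith.of_dist_le_mul (K := 2) fun x y => by
    simpa [dist_eq_norm] using norm_radialRetraction_sub_le hR x y).continuous

variable {E F : Type*} [NormedAddCommGroup E] [InnerProductSpace ℝ E] [CompleteSpace E]
  [FiniteDimensional ℝ E] [MetricSpace F] [SecondCountableTopology F] [MeasurableSpace F]
  [BorelSpace F] {T β η M μ : ℝ} {ψ : ℝ → E → ℝ} {f : ℝ → E → F → E} {U : Set F}

namespace IsConstraint

omit [FiniteDimensional ℝ E] in
lemma contDiffOn_gradient (h : IsConstraint T β η ψ) :
    ContDiffOn ℝ 1 (fun p : ℝ × E => gradient (ψ p.1) p.2) (Icc (0 : ℝ) T ×ˢ univ) := by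
  have h1 : ContDiffOn ℝ 1 (fun p : ℝ × E => (InnerProductSpace.toDual ℝ E).symm
      ((fderivWithin ℝ (fun p : ℝ × E => ψ p.1 p.2) (Icc (0 : ℝ) T ×ˢ univ) p).comp
        (ContinuousLinearMap.inr ℝ ℝ E))) (Icc (0 : ℝ) T ×ˢ univ) :=
    (InnerProductSpace.toDual ℝ E).symm.contDiff.comp_contDiffOn
      (h.contDiffOn_fderivWithin.clm_comp contDiffOn_const)
  exact h1.congr fun p hp => h.gradient_eq hp.1 p.2

/-- Existence for the penalized equation. -/
lemma exists_penalizedSolution (h : IsConstraint T β η ψ) (hf : IsDynamics T M f U)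
    (hμ : IsRateBound T μ f ψ U) (hμ0 : 0 < μ) {σ γ : ℝ} (hγ : 0 < γ)
    (he : -β ≤ σ + penaltyLevel μ η γ) (he' : σ + penaltyLevel μ η γ < η) {u : ℝ → F}
    (hum : Measurable u) (huU : ∀ t, u t ∈ U) {b : E} (hb : b ∈ enlargedSet ψ μ η σ γ 0) :
    ∃ x, x 0 = b ∧ IsPenalizedSolution T f ψ σ γ u x := by
  have hT := h.pos.le
  have : ProperSpace E := FiniteDimensional.proper ℝ E
  obtain ⟨R, hR0, hR⟩ : ∃ R, 0 < R ∧ ∀ t ∈ Icc 0 T, ∀ x, ψ t x ≤ η → ‖x‖ ≤ R := by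
    obtain ⟨R, hR⟩ := h.exists_bound hμ0 (fun t ht x hx => by
      have := hμ t ht (u t) (huU t) x (mem_movingSet_add hx)
      have h2 : 0 ≤ ‖gradient (ψ t) x‖ * ‖f t x (u t)‖ := by positivity
      linarith)
    exact ⟨max R 1, by positivity, fun t ht x hx => (hR t ht x hx).trans (le_max_left _ _)⟩
  have hproj : ∀ t, (projIcc 0 T hT t : ℝ) ∈ Icc 0 T := fun t => (projIcc 0 T hT t).2
  set H : ℝ × E → E := fun p => penaltyMultiplier σ γ (ψ p.1 p.2) • gradient (ψ p.1) p.2 with hH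
  have hHd : ContDiffOn ℝ 1 H (Icc (0 : ℝ) T ×ˢ univ) := by
    have h1 : ContDiff ℝ 1 (penaltyMultiplier σ γ) := by
      unfold penaltyMultiplier
      fun_prop
    exact (h1.comp_contDiffOn (h.contDiffOn.of_le (by norm_num))).smul h.contDiffOn_gradient
  have hball : Icc (0 : ℝ) T ×ˢ Metric.closedBall (0 : E) R ⊆ Icc (0 : ℝ) T ×ˢ univ :=
    prod_mono_right (subset_univ _)
  have hcomp := (isCompact_Icc (a := (0 : ℝ)) (b := T)).prod (isCompact_closedBall (0 : E) R)
  obtain ⟨K, hK⟩ := (hHd.mono hball).exists_lipschitzOnWith (by norm_num)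
    ((convex_Icc 0 T).prod (convex_closedBall 0 R)) hcomp
  obtain ⟨G, hG⟩ := hcomp.exists_bound_of_continuousOn (hHd.continuousOn.mono hball)
  have hmem : ∀ t (x : E), ((projIcc 0 T hT t : ℝ), radialRetraction R x) ∈
      Icc (0 : ℝ) T ×ˢ Metric.closedBall (0 : E) R := fun t x =>
    ⟨hproj t, by simpa using norm_radialRetraction_le hR0 x⟩
  have hrc := continuous_radialRetraction (W := E) hR0
  have hHc : Continuous fun p : ℝ × E => H (projIcc 0 T hT p.1, radialRetraction R p.2) :=
    hHd.continuousOn.comp_continuous (by fun_prop) fun p => hball (hmem p.1 p.2)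
  have hfc := continuous_projIcc_comp hf.continuousOn hT
  -- Only the penalty term needs a cutoff, as `f` is already globally bounded and Lipschitz. The
  -- retraction is the identity where `ψ ≤ η`, and invariance keeps the solution there.
  obtain ⟨x, hx0, hxL, hxd⟩ := exists_caratheodory_solution
    (φ := fun t x => f (projIcc 0 T hT t) x (u t) - H (projIcc 0 T hT t, radialRetraction R x))
    (K := Real.toNNReal (M + K * 2)) (B := Real.toNNReal (M + G)) hT
    (fun x hx => by
      borelize E
      refine Measurable.aestronglyMeasurable ?_
      have h1 : Measurable fun t => (t, x t, u t) :=
        measurable_id.prodMk (hx.measurable.prodMk hum)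
      have h2 : Continuous fun t => H (projIcc 0 T hT t, radialRetraction R (x t)) :=
        hHc.comp (continuous_id.prodMk hx)
      exact (hfc.measurable.comp h1).sub h2.measurable)
    (fun t x y => by
      refine le_trans ?_ (mul_le_mul_of_nonneg_right (Real.le_coe_toNNReal _) (norm_nonneg _))
      have h1 := hf.lipschitz _ (hproj t) _ (huU t) x y
      have h2 := hK.dist_le_mul _ (hmem t x) _ (hmem t y)
      rw [Prod.dist_eq, dist_self, max_eq_right dist_nonneg, dist_eq_norm, dist_eq_norm] at h2
      have h3 := mul_le_mul_of_nonneg_left (norm_radialRetraction_sub_le hR0 x y) K.2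
      rw [sub_sub_sub_comm]
      refine (norm_sub_le _ _).trans ?_
      have h4 := h2.trans h3
      rw [add_mul, mul_assoc]
      exact add_le_add h1 h4)
    (fun t x => (norm_sub_le _ _).trans ((add_le_add (hf.norm_le _ (hproj t) _ _ (huU t))
      (hG _ (hmem t x))).trans (Real.le_coe_toNNReal _))) b
  have hu : IsControl T U u := ⟨hum.aemeasurable, Eventually.of_forall huU⟩
  have hd : ∀ᵐ t ∂(volume.restrict (Icc (0 : ℝ) T)), ψ t (x t) ≤ η → HasDerivAt x
      (f t (x t) (u t) - penaltyMultiplier σ γ (ψ t (x t)) • gradient (ψ t) (x t)) t := by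
    filter_upwards [hxd, ae_restrict_mem measurableSet_Icc] with t ht htT hψt
    rw [projIcc_of_mem hT htT, radialRetraction_of_norm_le hR0 (hR t htT _ hψt)] at ht
    exact ht
  have h0 : ψ 0 (x 0) ≤ σ + penaltyLevel μ η γ := by
    rw [hx0]
    have h0' : ψ 0 b - σ ≤ penaltyLevel μ η γ := hb
    linarith
  have hinv := h.mem_enlargedSet_of_penalized hμ hγ hμ0 he he' hu ⟨_, hxL⟩ h0 hd
  refine ⟨x, hx0, absolutelyContinuous_of_lipschitzOnWith hT hxL, ?_⟩
  filter_upwards [hd, ae_restrict_mem measurableSet_Icc] with t ht htT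
  exact ht ((hinv t htT).trans he'.le)

end IsConstraint

end Existence

/-! ### Convergence of the penalized solutions -/

section Convergence

lemma tendstoUniformlyOn_of_add {X : Type*} [PseudoMetricSpace X] {x : ℕ → ℝ → X} {y : ℝ → X}
    {s : Set ℝ} (N : ℕ) (h : TendstoUniformlyOn (fun k => x (k + N)) y atTop s) :
    TendstoUniformlyOn x y atTop s := fun v hv => by
  obtain ⟨k₀, hk₀⟩ := eventually_atTop.1 (h v hv)
  refine eventually_atTop.2 ⟨k₀ + N, fun k hk => ?_⟩
  have := hk₀ (k - N) (by omega)
  simpa only [Nat.sub_add_cancel (show N ≤ k by omega)] using this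

variable {E F : Type*} [NormedAddCommGroup E] [InnerProductSpace ℝ E] [CompleteSpace E]
  [FiniteDimensional ℝ E] [MetricSpace F] [SecondCountableTopology F] [MeasurableSpace F]
  [BorelSpace F] {T β η M μ : ℝ} {ψ : ℝ → E → ℝ} {f : ℝ → E → F → E} {U : Set F}

namespace IsConstraint

-- The `1` in the rate bound gives positivity once `C(0)` has a point, and the error bound, started
-- at the origin, supplies one.
omit [MetricSpace F] [SecondCountableTopology F] [MeasurableSpace F] [BorelSpace F] in
lemma rateBound_pos (h : IsConstraint T β η ψ) (hμ : IsRateBound T μ f ψ U) (hU : U.Nonempty) :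
    0 < μ := by
  obtain ⟨u, hu⟩ := hU
  have h0 : (0 : ℝ) ∈ Icc 0 T := ⟨le_rfl, h.pos.le⟩
  obtain ⟨z, hz, -⟩ := h.exists_le_of_le_add h0 (a := 0) (e := max (ψ 0 0) 0) (x := 0)
    (by linarith [h.beta_pos]) (le_max_right _ _) (by simp)
  have h1 := hμ 0 h0 u hu z (mem_movingSet_add hz)
  have h2 : 0 ≤ ‖gradient (ψ 0) z‖ * ‖f 0 z u‖ := by positivity
  have h3 := abs_nonneg (derivWithin (fun s => ψ s z) (Icc 0 T) 0)
  linarith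

omit [FiniteDimensional ℝ E] [MetricSpace F] [SecondCountableTopology F] [BorelSpace F] in
lemma nonempty_of_isControl (h : IsConstraint T β η ψ) {u : ℝ → F} (hu : IsControl T U u) :
    U.Nonempty := by
  have : NeZero (volume.restrict (Icc (0 : ℝ) T)) := ⟨by
    simpa [Measure.restrict_eq_zero] using h.pos⟩
  obtain ⟨t, ht⟩ := hu.2.exists
  exact ⟨_, ht⟩

omit [FiniteDimensional ℝ E] in
lemma exists_level_bounds (h : IsConstraint T β η ψ) (hμ0 : 0 < μ) {σ γ : ℕ → ℝ}
    (hσ : Tendsto σ atTop (𝓝 0)) (hγ : Tendsto γ atTop atTop) :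
    ∃ N, ∀ k, -β ≤ σ (k + N) + penaltyLevel μ η (γ (k + N)) ∧
      σ (k + N) + penaltyLevel μ η (γ (k + N)) < η := by
  have h1 := hσ.add (tendsto_penaltyLevel hμ0 h.eta_pos hγ)
  rw [add_zero] at h1
  obtain ⟨N, hN⟩ := eventually_atTop.1 ((h1.eventually_const_le
    (show -β < 0 by linarith [h.beta_pos])).and (h1.eventually_lt_const h.eta_pos))
  exact ⟨N, fun k => hN (k + N) (Nat.le_add_left _ _)⟩

omit [SecondCountableTopology F] in
/-- Penalized solutions with arbitrary controls have a subsequence converging to a sweeping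
solution. -/
theorem exists_subseq_sweepingSolution (h : IsConstraint T β η ψ) (hf : IsDynamics T M f U)
    (hμ : IsRateBound T μ f ψ U) {σ γ : ℕ → ℝ} (hσ : Tendsto σ atTop (𝓝 0))
    (hγ0 : ∀ k, 0 < γ k) (hγ : Tendsto γ atTop atTop) {u : ℕ → ℝ → F} {x : ℕ → ℝ → E} {x₀ : E}
    (hu : ∀ k, IsControl T U (u k))
    (hx : ∀ k, IsPenalizedSolution T f ψ (σ k) (γ k) (u k) (x k))
    (h0 : ∀ k, x k 0 ∈ enlargedSet ψ μ η (σ k) (γ k) 0)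
    (hx₀ : Tendsto (fun k => x k 0) atTop (𝓝 x₀)) :
    ∃ (κ : ℕ → ℕ) (y : ℝ → E) (v : ℝ → F), StrictMono κ ∧
      TendstoUniformlyOn (fun j => x (κ j)) y atTop (Icc 0 T) ∧ IsControl T U v ∧
      IsSweepingSolution T f ψ v x₀ y ∧
      ((∀ k, u k = u 0) → IsSweepingSolution T f ψ (u 0) x₀ y) := by
  have hμ0 := h.rateBound_pos hμ (h.nonempty_of_isControl (hu 0))
  obtain ⟨N, hN⟩ := h.exists_level_bounds hμ0 hσ hγ
  obtain ⟨κ, y, hκ, hy, ⟨L, hL⟩, hd⟩ := h.exists_subseq_limit hf hμ hμ0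
    (σ := fun k => σ (k + N)) (γ := fun k => γ (k + N)) (u := fun k => u (k + N))
    (x := fun k => x (k + N)) ((tendsto_add_atTop_iff_nat N).2 hσ) (fun k => hγ0 _)
    ((tendsto_add_atTop_iff_nat N).2 hγ) (fun k => (hN k).1) (fun k => (hN k).2)
    (fun k => hu _) (fun k => hx _) (fun k => h0 _)
  have hκN : StrictMono fun j => κ j + N := fun i j hij => Nat.add_lt_add_right (hκ hij) N
  have hy0 : y 0 = x₀ := tendsto_nhds_unique (hy.tendsto_at ⟨le_rfl, h.pos.le⟩)
    (hx₀.comp hκN.tendsto_atTop)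
  have hac := absolutelyContinuous_of_lipschitzOnWith h.pos.le hL
  obtain ⟨v, hvm, hvU, hv⟩ := h.exists_control hf hL.continuousOn (by
    filter_upwards [hd] with t ht
    obtain ⟨h1, a, ha, l, hl, hl', hdt, -⟩ := ht
    exact ⟨h1, a, ha, l, hl, hl', hdt⟩)
  refine ⟨fun j => κ j + N, y, v, hκN, hy, ⟨hvm.aemeasurable, Eventually.of_forall hvU⟩,
    h.isSweepingSolution_iff.2 ⟨hac, hy0, hv⟩, fun hc =>
    h.isSweepingSolution_iff.2 ⟨hac, hy0, ?_⟩⟩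
  filter_upwards [hd] with t ht
  obtain ⟨h1, a, ha, l, hl, hl', hdt, hat⟩ := ht
  have hat' := hat fun k => (hc _).trans (hc _).symm
  -- The limit was taken along the sequence shifted by `N`, whose first control is `u (0 + N)`.
  rw [hc (0 + N)] at hat'
  exact ⟨h1, l, hl, hl', hat' ▸ hdt⟩

omit [SecondCountableTopology F] in
/-- Penalized solutions with a common control converge to the sweeping solution. -/
theorem exists_tendstoUniformlyOn (h : IsConstraint T β η ψ) (hf : IsDynamics T M f U)
    (hμ : IsRateBound T μ f ψ U) {σ γ : ℕ → ℝ} (hσ : Tendsto σ atTop (𝓝 0))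
    (hγ0 : ∀ k, 0 < γ k) (hγ : Tendsto γ atTop atTop) {u : ℝ → F} {x : ℕ → ℝ → E} {x₀ : E}
    (hu : IsControl T U u) (hx : ∀ k, IsPenalizedSolution T f ψ (σ k) (γ k) u (x k))
    (h0 : ∀ k, x k 0 ∈ enlargedSet ψ μ η (σ k) (γ k) 0)
    (hx₀ : Tendsto (fun k => x k 0) atTop (𝓝 x₀)) :
    ∃ y, IsSweepingSolution T f ψ u x₀ y ∧ TendstoUniformlyOn x y atTop (Icc 0 T) := by
  obtain ⟨-, y, -, -, -, -, -, hy⟩ := h.exists_subseq_sweepingSolution hf hμ hσ hγ0 hγ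
    (u := fun _ => u) (fun _ => hu) hx h0 hx₀
  have hyu := hy fun _ => rfl
  refine ⟨y, hyu, ?_⟩
  -- A subsequence staying `ε` away from `y` would have a further subsequence converging to a
  -- sweeping solution with the same control, which is `y` by uniqueness.
  by_contra hnot
  rw [Metric.tendstoUniformlyOn_iff] at hnot
  push Not at hnot
  obtain ⟨ε, hε, hfr⟩ := hnot
  obtain ⟨φ, hφ, hbad⟩ := extraction_of_frequently_atTop hfr
  obtain ⟨κ, z, -, -, hz, -, -, hzu⟩ := h.exists_subseq_sweepingSolution hf hμ
    (hσ.comp hφ.tendsto_atTop) (fun k => hγ0 _) (hγ.comp hφ.tendsto_atTop)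
    (u := fun _ => u) (fun _ => hu) (fun k => hx (φ k)) (fun k => h0 (φ k))
    (hx₀.comp hφ.tendsto_atTop)
  have heq := h.sweeping_unique hf hμ hu hyu (hzu fun _ => rfl)
  obtain ⟨j, hj⟩ := (Metric.tendstoUniformlyOn_iff.1 hz ε hε).exists
  obtain ⟨t, ht, hbt⟩ := hbad (κ j)
  have := hj t ht
  rw [← heq ht] at this
  exact absurd this (not_lt.2 hbt)

/-- Every solution of the sweeping inclusion is a limit of penalized solutions with one control. -/
theorem exists_control_approximation (h : IsConstraint T β η ψ) (hf : IsDynamics T M f U)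
    (hμ : IsRateBound T μ f ψ U) {σ γ : ℕ → ℝ} (hσ : Tendsto σ atTop (𝓝 0))
    (hγ0 : ∀ k, 0 < γ k) (hγ : Tendsto γ atTop atTop) {x₀ : E} {y : ℝ → E}
    (hy : IsInclusionSolution T f ψ U x₀ y) :
    ∃ u : ℝ → F, IsControl T U u ∧ IsSweepingSolution T f ψ u x₀ y ∧
      ∀ b : ℕ → E, (∀ k, b k ∈ enlargedSet ψ μ η (σ k) (γ k) 0) → Tendsto b atTop (𝓝 x₀) →
        ∃ x : ℕ → ℝ → E, (∀ k, x k 0 = b k) ∧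
          (∀ᶠ k in atTop, IsPenalizedSolution T f ψ (σ k) (γ k) u (x k)) ∧
          TendstoUniformlyOn x y atTop (Icc 0 T) := by
  obtain ⟨hac, hy0, hd⟩ := hy
  have hcont : ContinuousOn y (Icc 0 T) := by simpa [uIcc_of_le h.pos.le] using hac.continuousOn
  obtain ⟨u, hum, huU, hu⟩ := h.exists_control hf hcont (by
    filter_upwards [hd, ae_restrict_mem measurableSet_Icc] with t ht htT
    obtain ⟨v, hv, hdt⟩ := ht
    obtain ⟨a, ha, n, hn, rfl⟩ := hv
    obtain ⟨h1, l, hl, hl', rfl⟩ := h.exists_smul_of_mem_normalCone htT hn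
    exact ⟨h1, a, ha, l, hl, hl', hdt⟩)
  have huc : IsControl T U u := ⟨hum.aemeasurable, Eventually.of_forall huU⟩
  have hys : IsSweepingSolution T f ψ u x₀ y := h.isSweepingSolution_iff.2 ⟨hac, hy0, hu⟩
  refine ⟨u, huc, hys, fun b hb hbx => ?_⟩
  have hμ0 := h.rateBound_pos hμ ⟨_, huU 0⟩
  obtain ⟨N, hN⟩ := h.exists_level_bounds hμ0 hσ hγ
  have hex : ∀ k, ∃ x : ℝ → E, x 0 = b k ∧
      (N ≤ k → IsPenalizedSolution T f ψ (σ k) (γ k) u x) := by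
    intro k
    by_cases hk : N ≤ k
    · have hNk := hN (k - N)
      rw [Nat.sub_add_cancel hk] at hNk
      obtain ⟨x, hx0, hx⟩ := h.exists_penalizedSolution hf hμ hμ0 (hγ0 k) hNk.1 hNk.2 hum huU (hb k)
      exact ⟨x, hx0, fun _ => hx⟩
    · exact ⟨fun _ => b k, rfl, fun hk' => absurd hk' hk⟩
  choose x hx0 hx using hex
  refine ⟨x, hx0, eventually_atTop.2 ⟨N, hx⟩, tendstoUniformlyOn_of_add N ?_⟩
  obtain ⟨z, hz, hxz⟩ := h.exists_tendstoUniformlyOn hf hμ (σ := fun k => σ (k + N))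
    (γ := fun k => γ (k + N)) (x := fun k => x (k + N)) (x₀ := x₀)
    ((tendsto_add_atTop_iff_nat N).2 hσ) (fun k => hγ0 _) ((tendsto_add_atTop_iff_nat N).2 hγ) huc
    (fun k => hx _ (Nat.le_add_left _ _)) (fun k => by rw [hx0]; exact hb _)
    (by simp only [hx0]; exact (tendsto_add_atTop_iff_nat N).2 hbx)
  exact hxz.congr_right (h.sweeping_unique hf hμ huc hz hys)

end IsConstraint

end Convergence

end Sweeping

theorem theorem1 {n m : ℕ} (T : ℝ) (hT : 0 < T)
    (f : ℝ → EuclideanSpace ℝ (Fin n) → EuclideanSpace ℝ (Fin m) → EuclideanSpace ℝ (Fin n))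
    (ψ : ℝ → EuclideanSpace ℝ (Fin n) → ℝ)
    (U : Set (EuclideanSpace ℝ (Fin m)))
    -- assumptions on the dynamics
    (hf_cont : ContinuousOn
      (fun p : ℝ × EuclideanSpace ℝ (Fin n) × EuclideanSpace ℝ (Fin m) => f p.1 p.2.1 p.2.2)
      (Icc (0 : ℝ) T ×ˢ univ))
    (hf_C1 : ∀ t ∈ Icc (0 : ℝ) T, ∀ u, ContDiff ℝ 1 (fun x => f t x u))
    (M : ℝ) (hM : 0 < M)
    (hf_bdd : ∀ t ∈ Icc (0 : ℝ) T, ∀ x, ∀ u ∈ U,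
      ‖f t x u‖ ≤ M ∧ ‖fderiv ℝ (fun y => f t y u) x‖ ≤ M)
    (hf_conv : ∀ t ∈ Icc (0 : ℝ) T, ∀ x, Convex ℝ ((fun u => f t x u) '' U))
    -- assumptions on the constraint function
    (hψ_C2 : ContDiffOn ℝ 2 (fun p : ℝ × EuclideanSpace ℝ (Fin n) => ψ p.1 p.2)
      (Icc (0 : ℝ) T ×ˢ univ))
    (hψ_coer : ∀ t ∈ Icc (0 : ℝ) T,
      Tendsto (ψ t) (Bornology.cobounded (EuclideanSpace ℝ (Fin n))) atTop)
    (β η : ℝ) (hβ : 0 < β) (hη : 0 < η)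
    (hψ_grad : ∀ t ∈ Icc (0 : ℝ) T, ∀ x, -β ≤ ψ t x → η < ‖gradient (ψ t) x‖)
    (hU : IsCompact U)
    -- the constant `μ` and the sequences `σ_k`, `γ_k`
    (μ : ℝ)
    (hμ : ∀ t ∈ Icc (0 : ℝ) T, ∀ u ∈ U,
      ∀ x ∈ Sweeping.movingSet ψ t + Metric.closedBall (0 : EuclideanSpace ℝ (Fin n)) 1,
        ‖gradient (ψ t) x‖ * ‖f t x u‖ + |derivWithin (fun s => ψ s x) (Icc 0 T) t| + 1 ≤ μ)
    (σ γ : ℕ → ℝ) (hσ_anti : Antitone σ) (hσ : Tendsto σ atTop (𝓝 0))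
    (hγ_pos : ∀ k, 0 < γ k) (hγ : Tendsto γ atTop atTop)
    (hCk : ∀ k, ∀ t ∈ Icc (0 : ℝ) T,
      Sweeping.movingSet ψ t ⊆ interior (Sweeping.enlargedSet ψ μ η (σ k) (γ k) t)) :
    -- uniqueness for the controlled sweeping process
    (∀ (u : ℝ → EuclideanSpace ℝ (Fin m)) (x₀ : EuclideanSpace ℝ (Fin n))
        (y z : ℝ → EuclideanSpace ℝ (Fin n)),
      Sweeping.IsControl T U u →
      Sweeping.IsSweepingSolution T f ψ u x₀ y →
      Sweeping.IsSweepingSolution T f ψ u x₀ z →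
      EqOn y z (Icc 0 T)) ∧
    -- arbitrary controls: a subsequence converges to a solution of the sweeping process
    (∀ (u : ℕ → ℝ → EuclideanSpace ℝ (Fin m)) (x : ℕ → ℝ → EuclideanSpace ℝ (Fin n))
        (x₀ : EuclideanSpace ℝ (Fin n)),
      (∀ k, Sweeping.IsControl T U (u k)) →
      (∀ k, Sweeping.IsPenalizedSolution T f ψ (σ k) (γ k) (u k) (x k)) →
      (∀ k, x k 0 ∈ Sweeping.enlargedSet ψ μ η (σ k) (γ k) 0) →
      Tendsto (fun k => x k 0) atTop (𝓝 x₀) →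
      ∃ (κ : ℕ → ℕ) (y : ℝ → EuclideanSpace ℝ (Fin n)) (v : ℝ → EuclideanSpace ℝ (Fin m)),
        StrictMono κ ∧
        TendstoUniformlyOn (fun j => x (κ j)) y atTop (Icc 0 T) ∧
        Sweeping.IsControl T U v ∧
        Sweeping.IsSweepingSolution T f ψ v x₀ y) ∧
    -- equal controls: convergence to the solution of the sweeping process with the same control
    (∀ (u : ℝ → EuclideanSpace ℝ (Fin m)) (x : ℕ → ℝ → EuclideanSpace ℝ (Fin n))
        (x₀ : EuclideanSpace ℝ (Fin n)),
      Sweeping.IsControl T U u →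
      (∀ k, Sweeping.IsPenalizedSolution T f ψ (σ k) (γ k) u (x k)) →
      (∀ k, x k 0 ∈ Sweeping.enlargedSet ψ μ η (σ k) (γ k) 0) →
      Tendsto (fun k => x k 0) atTop (𝓝 x₀) →
      ∃ y : ℝ → EuclideanSpace ℝ (Fin n),
        Sweeping.IsSweepingSolution T f ψ u x₀ y ∧
        TendstoUniformlyOn x y atTop (Icc 0 T)) ∧
    -- every solution of the sweeping inclusion is a limit of penalized solutions, with one control
    (∀ (x₀ : EuclideanSpace ℝ (Fin n)) (y : ℝ → EuclideanSpace ℝ (Fin n)),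
      x₀ ∈ Sweeping.movingSet ψ 0 →
      Sweeping.IsInclusionSolution T f ψ U x₀ y →
      ∃ u : ℝ → EuclideanSpace ℝ (Fin m),
        Sweeping.IsControl T U u ∧
        Sweeping.IsSweepingSolution T f ψ u x₀ y ∧
        ∀ b : ℕ → EuclideanSpace ℝ (Fin n),
          (∀ k, b k ∈ Sweeping.enlargedSet ψ μ η (σ k) (γ k) 0) →
          Tendsto b atTop (𝓝 x₀) →
          ∃ x : ℕ → ℝ → EuclideanSpace ℝ (Fin n),
            (∀ k, x k 0 = b k) ∧
            (∀ᶠ k in atTop, Sweeping.IsPenalizedSolution T f ψ (σ k) (γ k) u (x k)) ∧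
            TendstoUniformlyOn x y atTop (Icc 0 T)) := by
  have h : Sweeping.IsConstraint T β η ψ := ⟨hT, hψ_C2, hψ_coer, hβ, hη, hψ_grad⟩
  have hf : Sweeping.IsDynamics T M f U :=
    { continuousOn := hf_cont
      norm_le := fun t ht x u hu => (hf_bdd t ht x u hu).1
      lipschitz := fun t ht u hu x y =>
        convex_univ.norm_image_sub_le_of_norm_fderiv_le (f := fun z => f t z u)
          (fun z _ => (hf_C1 t ht u).differentiable (by norm_num) z)
          (fun z _ => (hf_bdd t ht z u hu).2) (mem_univ y) (mem_univ x)
      convex := hf_conv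
      isCompact := hU
      pos := hM }
  have hμ' : Sweeping.IsRateBound T μ f ψ U := hμ
  refine ⟨fun u x₀ y z hu hy hz => h.sweeping_unique hf hμ' hu hy hz,
    fun u x x₀ hu hx h0 hx₀ => ?_,
    fun u x x₀ hu hx h0 hx₀ => h.exists_tendstoUniformlyOn hf hμ' hσ hγ_pos hγ hu hx h0 hx₀,
    fun x₀ y _ hy => h.exists_control_approximation hf hμ' hσ hγ_pos hγ hy⟩
  obtain ⟨κ, y, v, hκ, hy, hv, hyv, -⟩ :=
    h.exists_subseq_sweepingSolution hf hμ' hσ hγ_pos hγ hu hx h0 hx₀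
  exact ⟨κ, y, v, hκ, hy, hv, hyv⟩
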